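/- Let $N\in\{2,3,4\}$ and let $V$ be an $N$-dimensional real vector space (the tangent space at a point of a Lorentzian manifold) with a Lorentzian metric $g$ of signature $(+,-,\dots,-)$ and a time orientation. For a $p$-form $\Omega$ on $V$ with $1\le p\le N-1$, the superenergy tensor is $$T_{ab}\{\Omega\}=\tfrac12\big[(\Omega\odot\Omega)_{ab}+({*\Omega}\odot{*\Omega})_{ab}\big],\qquad (A\odot A)_{ab}=\frac{(-1)^{n-1}}{(n-1)!}A_{ac_2\dots c_n}A_b{}^{c_2\dots c_n}\ \text{ for an } n\text{-form } A,$$ where $*$ is the Hodge dual; for an $N$-form $\Omega=f\eta$, with $\eta$ the volume form, $T_{ab}\{\Omega\}=\tfrac12f^2g_{ab}$. Let $\mathcal{SE}_2$ be the set of the superenergy tensors of all $p$-forms, $1\le p\le N$, and $\mathcal{SS}$ the set of the superenergy tensors of simple $p$-forms, $1\le p\le N$, a $p$-form being simple if it is a wedge product of $p$ linearly independent 1-forms. Write $-\mathcal{SE}_2=\{T: -T\in\mathcal{SE}_2\}$. A linear map of $V$ is null-cone preserving if it maps null vectors to null vectors (the zero vector counting as null); it is then orthochronous (time-reversing) if it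 maps every future-pointing null vector to zero or to a future-pointing (past-pointing) null vector. A rank-2 tensor $T_{ab}$ is identified with the map $k^a\mapsto k^aT_a{}^b$, and it is bi-preserving if both this map and $k_b\mapsto T_a{}^bk_b$ preserve the null cone. Then: (1) $\mathcal{SE}_2\setminus\{0\}=\mathcal{SS}$. (2) $\mathcal{SE}_2$ is exactly the set of symmetric tensors $T_{ab}$ that leave the null cone invariant and preserve its time orientation (orthochronous null-cone preserving maps). (3) $\mathcal{SE}_2$ is the union of the set of all positive multiples of involutory orthochronous Lorentz transformations and the set of all symmetric singular orthochronous null-cone bi-preserving maps. (4) $-\mathcal{SE}_2$ is exactly the set of symmetric tensors that leave the null cone invariant and reverse its time orientation; it is the union of the set of all positive multiples of involutory time-reversing Lorentz transformations and the set of all symmetric singular time-reversing null-cone bi-preserving maps. -/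

import Mathlib

open LinearMap (BilinForm)

namespace Superenergy

noncomputable section

variable {V : Type*} [AddCommGroup V] [Module ℝ V] {N : ℕ}

/-- The signs `+, -, …, -` of a Lorentzian metric in an orthonormal frame. -/
def sgn (i : Fin N) : ℝ := if (i : ℕ) = 0 then 1 else -1

/-- `e` is an orthonormal frame of the metric `g` of signature `+, -, …, -`. For `N ≥ 1`, a bilinear
form is a Lorentzian metric exactly when it has such a frame. -/
def IsLorentzFrame (g : BilinForm ℝ V) (e : Module.Basis (Fin N) ℝ V) : Prop :=
  ∀ i j, g (e i) (e j) = if i = j then sgn i else 0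

/-! ### Superenergy tensors of forms

All index contractions with the metric are carried out in an orthonormal frame `e`, where the
inverse metric is `∑ i, sgn i • e i ⊗ e i`; they do not depend on the frame. -/

/-- The tensor `(A ⊙ A)_{ab} = (-1)^(n-1) / (n-1)! A_{a c₂ … cₙ} A_b^{c₂ … cₙ}` of a form `A` with
`n = k + 1` indices. -/
def semiSquare (e : Module.Basis (Fin N) ℝ V) {k : ℕ} (A : V [⋀^Fin (k + 1)]→ₗ[ℝ] ℝ) :
    BilinForm ℝ V :=
  LinearMap.mk₂ ℝ
    (fun u v => (-1) ^ k / (k.factorial : ℝ) * ∑ c : Fin k → Fin N, (∏ i, sgn (c i)) *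
      (A.curryLeft u (fun i => e (c i)) * A.curryLeft v (fun i => e (c i))))
    (fun u u' v => by simp [add_mul, mul_add, Finset.sum_add_distrib])
    (fun r u v => by
      simp only [map_smul, AlternatingMap.smul_apply, smul_eq_mul, Finset.mul_sum]
      exact Finset.sum_congr rfl fun _ _ => by ring)
    (fun u v v' => by simp [mul_add, Finset.sum_add_distrib])
    (fun r u v => by
      simp only [map_smul, AlternatingMap.smul_apply, smul_eq_mul, Finset.mul_sum]
      exact Finset.sum_congr rfl fun _ _ => by ring)

theorem semiSquare_apply (e : Module.Basis (Fin N) ℝ V) {k : ℕ} (A : V [⋀^Fin (k + 1)]→ₗ[ℝ] ℝ)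
    (u v : V) :
    semiSquare e A u v = (-1) ^ k / (k.factorial : ℝ) * ∑ c : Fin k → Fin N, (∏ i, sgn (c i)) *
      (A (Fin.cons u (fun i => e (c i))) * A (Fin.cons v (fun i => e (c i)))) :=
  rfl

/-- The identification of `N` slots with `p` slots followed by `q` slots. -/
def splitSlots {p q : ℕ} (h : p + q = N) : Fin N ≃ Fin p ⊕ Fin q :=
  (finCongr h.symm).trans finSumFinEquiv.symm

/-- The `q`-form `v ↦ η (w₁, …, w_p, v₁, …, v_q)` got by filling the first `p` slots of an
`N`-form `η`. -/
def fillSlots {p q : ℕ} (h : p + q = N) (η : V [⋀^Fin N]→ₗ[ℝ] ℝ) (w : Fin p → V) :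
    V [⋀^Fin q]→ₗ[ℝ] ℝ :=
  { (MultilinearMap.currySum (N := fun _ : Fin p ⊕ Fin q => V)
      (η.toMultilinearMap.domDomCongr (splitSlots h))) w with
    map_eq_zero_of_eq' := fun v i j hv hij => by
      change η (fun s => Sum.elim w v (splitSlots h s)) = 0
      refine η.map_eq_zero_of_eq _ (i := (splitSlots h).symm (Sum.inr i))
        (j := (splitSlots h).symm (Sum.inr j)) (by simpa using hv) ?_
      intro hs
      exact hij (Sum.inr_injective ((splitSlots h).symm.injective hs)) }

theorem fillSlots_apply {p q : ℕ} (h : p + q = N) (η : V [⋀^Fin N]→ₗ[ℝ] ℝ) (w : Fin p → V)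
    (v : Fin q → V) : fillSlots h η w v = η (fun s => Sum.elim w v (splitSlots h s)) :=
  rfl

/-- The Hodge dual `(*Ω)_{b₁ … b_q} = (1 / p!) η_{a₁ … a_p b₁ … b_q} Ω^{a₁ … a_p}`, `q = N - p`, of
a `p`-form, where the volume form `η` is the determinant in the orthonormal frame. -/
def hodgeDual (e : Module.Basis (Fin N) ℝ V) {p q : ℕ} (h : p + q = N)
    (Ω : V [⋀^Fin p]→ₗ[ℝ] ℝ) : V [⋀^Fin q]→ₗ[ℝ] ℝ :=
  ((p.factorial : ℝ)⁻¹) • ∑ c : Fin p → Fin N,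
    ((∏ i, sgn (c i)) * Ω (fun i => e (c i))) • fillSlots h e.det (fun i => e (c i))

/-- The superenergy tensor of a `p`-form in dimension `N`, where `p = k + 1` and `q = N - p`:
`(1/2) (Ω ⊙ Ω + *Ω ⊙ *Ω)` if `1 ≤ p ≤ N - 1`, and `(1/2) f² g` if `p = N` and `Ω = f η`. -/
def superenergy (g : BilinForm ℝ V) (e : Module.Basis (Fin N) ℝ V) {k : ℕ} :
    {q : ℕ} → k + 1 + q = N → (V [⋀^Fin (k + 1)]→ₗ[ℝ] ℝ) → BilinForm ℝ V
  | 0, h, Ω => ((1 / 2 : ℝ) * Ω (fun i => e (Fin.cast h i)) ^ 2) • g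
  | _ + 1, h, Ω => (1 / 2 : ℝ) • (semiSquare e Ω + semiSquare e (hodgeDual e h Ω))

/-- The wedge product `ω₁ ∧ … ∧ ω_p` of 1-forms, `v ↦ det (ω_i (v_j))`. -/
def wedge {p : ℕ} (ω : Fin p → Module.Dual ℝ V) : V [⋀^Fin p]→ₗ[ℝ] ℝ :=
  Matrix.detRowAlternating.compLinearMap (LinearMap.pi ω)

/-- A `p`-form is simple if it is a wedge product of `p` linearly independent 1-forms. -/
def IsSimpleForm {p : ℕ} (Ω : V [⋀^Fin p]→ₗ[ℝ] ℝ) : Prop :=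
  ∃ ω : Fin p → Module.Dual ℝ V, LinearIndependent ℝ ω ∧ Ω = wedge ω

/-- The set of rank-2 superenergy tensors: those of arbitrary `p`-forms, `1 ≤ p ≤ N`. -/
def SE₂ (g : BilinForm ℝ V) (e : Module.Basis (Fin N) ℝ V) : Set (BilinForm ℝ V) :=
  {T | ∃ (k q : ℕ) (h : k + 1 + q = N) (Ω : V [⋀^Fin (k + 1)]→ₗ[ℝ] ℝ), T = superenergy g e h Ω}

/-- The set of superenergy tensors of simple `p`-forms, `1 ≤ p ≤ N`. -/
def SS (g : BilinForm ℝ V) (e : Module.Basis (Fin N) ℝ V) : Set (BilinForm ℝ V) :=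
  {T | ∃ (k q : ℕ) (h : k + 1 + q = N) (Ω : V [⋀^Fin (k + 1)]→ₗ[ℝ] ℝ),
    IsSimpleForm Ω ∧ T = superenergy g e h Ω}

/-! ### Maps preserving the null cone -/

/-- The linear map `k^a ↦ k^a T_a^b` of a rank-2 tensor `T_{ab}`. -/
def raise (e : Module.Basis (Fin N) ℝ V) (T : BilinForm ℝ V) : V →ₗ[ℝ] V :=
  ∑ i, sgn i • (T.flip (e i)).smulRight (e i)

theorem metric_raise {g : BilinForm ℝ V} {e : Module.Basis (Fin N) ℝ V} (he : IsLorentzFrame g e)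
    (T : BilinForm ℝ V) (u v : V) : g (raise e T u) v = T u v := by
  have hs : ∀ j : Fin N, sgn j * sgn j = 1 := fun j => by
    unfold sgn; split_ifs <;> norm_num
  have key : g (raise e T u) = T u := by
    refine e.ext fun j => ?_
    simp only [raise, LinearMap.sum_apply, LinearMap.smul_apply, LinearMap.smulRight_apply,
      BilinForm.flip_apply, map_sum, map_smul, smul_eq_mul]
    rw [Finset.sum_eq_single j]
    · rw [he j j, if_pos rfl]
      linear_combination (T u (e j)) * hs j
    · intro i _ hij
      rw [he i j, if_neg hij]; ring
    · simp
  rw [key]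

/-- The map sends null vectors to null vectors (the zero vector counts as null). -/
def IsNullConePreserving (g : BilinForm ℝ V) (f : V →ₗ[ℝ] V) : Prop :=
  ∀ k, g k k = 0 → g (f k) (f k) = 0

/-- `k` is a nonzero null vector that points to the future, for the time orientation in which the
timelike vector `τ` is future-pointing. -/
def IsFutureNull (g : BilinForm ℝ V) (τ k : V) : Prop :=
  g k k = 0 ∧ 0 < g τ k

/-- A null-cone preserving map that keeps the cone's time orientation. A singular map may send null
vectors to zero. -/
def IsOrthochronous (g : BilinForm ℝ V) (τ : V) (f : V →ₗ[ℝ] V) : Prop :=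
  IsNullConePreserving g f ∧ ∀ k, IsFutureNull g τ k → f k = 0 ∨ IsFutureNull g τ (f k)

/-- A null-cone preserving map that reverses the cone's time orientation. A singular map may send
null vectors to zero. -/
def IsTimeReversal (g : BilinForm ℝ V) (τ : V) (f : V →ₗ[ℝ] V) : Prop :=
  IsNullConePreserving g f ∧ ∀ k, IsFutureNull g τ k → f k = 0 ∨ IsFutureNull g τ (-f k)

/-- Both `k^a ↦ k^a T_a^b` and `k_b ↦ T_a^b k_b` send null vectors to null vectors. -/
def IsNullConeBiPreserving (g : BilinForm ℝ V) (e : Module.Basis (Fin N) ℝ V)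
    (T : BilinForm ℝ V) : Prop :=
  IsNullConePreserving g (raise e T) ∧ IsNullConePreserving g (raise e T.flip)

/-- The map is singular. -/
def IsSingular (f : V →ₗ[ℝ] V) : Prop := LinearMap.det f = 0

/-- A Lorentz transformation: a linear map that preserves the metric. -/
def IsLorentzTransformation (g : BilinForm ℝ V) (L : V →ₗ[ℝ] V) : Prop :=
  ∀ u v, g (L u) (L v) = g u v

/-- The map is its own inverse. -/
def IsInvolutory (L : V →ₗ[ℝ] V) : Prop := L ∘ₗ L = LinearMap.id

end

end Superenergy

/-! Let `f` be the map of a symmetric tensor `T`. If `f` preserves the null cone, the form `g (f u)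
(f v)` vanishes on null vectors, so it equals `l • g` (`IsLorentzFrame.eq_smul_of_null`). Since `f`
is self-adjoint, `f² = l`. Orthochronicity forces `l ≥ 0` (`exists_raise_sq`).

If `l = 0`, the image of `f` is totally null, hence at most a line. So `T` is zero or `γ x ⊗ x` with
`γ > 0` and `x` null: the superenergy tensor of a null one-form (`mem_SS_of_nilpotent`).

If `l = μ² > 0`, `f / μ` is a self-adjoint involution and `V` splits orthogonally into the
eigenspaces `E₊`, `E₋` of `f` for `μ` and `-μ`. As `T (e 0) (e 0) ≥ 0`, `E₊` contains a timelike
vector, so `E₋` is negative definite. The cases `E₋ = 0`, `dim E₋ = 1` and `dim E₊ = 1` come from an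
`N`-form, a spacelike and a timelike one-form. Otherwise `N ≤ 4` forces both dimensions to be 2, and
a simple two-form does it (`mem_SS_of_conformal`).

Conversely, degrees `1` and `N - 1` reduce to one-forms by duality, degree `N` gives a nonnegative
multiple of `g`, and only two-forms in dimension four remain. There `f²` is scalar by the Rainich
identity, and positivity is a sum of squares.

Part (3) is the dichotomy `l > 0` or `l = 0`; part (4) follows by negation. -/

namespace Superenergy

/-! ### Lorentzian geometry of the null cone -/

section Geometry

variable {V : Type*} [AddCommGroup V] [Module ℝ V] {N : ℕ} {g : BilinForm ℝ V}
  {e : Module.Basis (Fin N) ℝ V} {τ : V}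

theorem sgn_mul_self (i : Fin N) : sgn i * sgn i = 1 := by
  unfold sgn; split_ifs <;> norm_num

theorem IsLorentzFrame.comm (he : IsLorentzFrame g e) (u v : V) : g u v = g v u := by
  have h : g = g.flip := by
    refine e.ext fun i => e.ext fun j => ?_
    rw [BilinForm.flip_apply, he, he]
    by_cases h : i = j
    · subst h; rfl
    · rw [if_neg h, if_neg (Ne.symm h)]
  rw [h, BilinForm.flip_apply, ← h]

theorem IsLorentzFrame.sum_smul (he : IsLorentzFrame g e) (v : V) :
    ∑ i, (sgn i * g v (e i)) • e i = v := by
  have h : ∑ i, sgn i • (g.flip (e i)).smulRight (e i) = (LinearMap.id : V →ₗ[ℝ] V) := by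
    refine e.ext fun j => ?_
    simp only [LinearMap.sum_apply, LinearMap.smul_apply, LinearMap.smulRight_apply,
      BilinForm.flip_apply, LinearMap.id_apply]
    rw [Finset.sum_eq_single j]
    · rw [he, if_pos rfl, smul_smul, sgn_mul_self, one_smul]
    · intro i _ hij
      rw [he, if_neg (Ne.symm hij), zero_smul, smul_zero]
    · simp
  have h' := LinearMap.congr_fun h v
  simpa [smul_smul] using h'

theorem IsLorentzFrame.sum_mul (he : IsLorentzFrame g e) (u v : V) :
    ∑ i, sgn i * (g u (e i) * g v (e i)) = g u v := by
  conv_rhs => rw [← he.sum_smul v]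
  rw [map_sum]
  refine Finset.sum_congr rfl fun i _ => ?_
  rw [map_smul, smul_eq_mul]; ring

theorem IsLorentzFrame.eq_of_forall (he : IsLorentzFrame g e) {u v : V}
    (h : ∀ w, g u w = g v w) : u = v := by
  rw [← he.sum_smul u, ← he.sum_smul v]
  exact Finset.sum_congr rfl fun i _ => by rw [h]

theorem IsLorentzFrame.exists_dual (he : IsLorentzFrame g e) (ω : Module.Dual ℝ V) :
    ∃ w, ∀ x, ω x = g w x := by
  refine ⟨∑ i, (sgn i * ω (e i)) • e i, fun x => ?_⟩
  conv_lhs => rw [← he.sum_smul x]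
  rw [map_sum, map_sum, LinearMap.sum_apply]
  refine Finset.sum_congr rfl fun i _ => ?_
  rw [map_smul, map_smul, LinearMap.smul_apply, smul_eq_mul, smul_eq_mul, he.comm x]
  ring

/-- Vectors orthogonal to a timelike vector are spacelike or zero. -/
theorem IsLorentzFrame.orthogonal_timelike (he : IsLorentzFrame g e) (hτ : 0 < g τ τ) {x : V}
    (hx : g τ x = 0) : g x x ≤ 0 ∧ (g x x = 0 → x = 0) := by
  obtain _ | n := N
  · rw [← he.sum_mul] at hτ
    simp at hτ
  have key : ∀ u v, g u v =
      g u (e 0) * g v (e 0) - ∑ i : Fin n, g u (e i.succ) * g v (e i.succ) := fun u v => by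
    rw [← he.sum_mul, Fin.sum_univ_succ, sub_eq_add_neg, ← Finset.sum_neg_distrib]
    simp [sgn]
  -- Cauchy–Schwarz on the spatial parts. Orthogonality to `τ` turns the left side into the product
  -- of the squared time components.
  have cs := Finset.sum_mul_sq_le_sq_mul_sq Finset.univ (fun i : Fin n => g τ (e i.succ))
    (fun i : Fin n => g x (e i.succ))
  rw [key] at hτ hx
  have hA : 0 ≤ ∑ i : Fin n, g τ (e i.succ) ^ 2 := Finset.sum_nonneg fun i _ => sq_nonneg _
  have hB : 0 ≤ ∑ i : Fin n, g x (e i.succ) ^ 2 := Finset.sum_nonneg fun i _ => sq_nonneg _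
  have hxx : g x x = g x (e 0) ^ 2 - ∑ i : Fin n, g x (e i.succ) ^ 2 := by
    rw [key]; simp only [← pow_two]
  simp only [← pow_two] at hτ
  rw [← sub_eq_zero.mp hx, mul_pow] at cs
  have hle : g x x ≤ 0 := by
    rw [hxx]
    by_contra! hlt
    nlinarith
  refine ⟨hle, fun h0 => ?_⟩
  rw [hxx, sub_eq_zero] at h0
  have hB0 : ∑ i : Fin n, g x (e i.succ) ^ 2 = 0 := by
    rw [h0] at cs
    nlinarith
  rw [hB0] at h0
  have hi := (Finset.sum_eq_zero_iff_of_nonneg fun i _ => sq_nonneg _).mp hB0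
  rw [← he.sum_smul x, Fin.sum_univ_succ, pow_eq_zero_iff two_ne_zero |>.mp h0]
  rw [Finset.sum_eq_zero fun i hi' => ?_]
  · simp
  · rw [pow_eq_zero_iff two_ne_zero |>.mp (hi i hi')]; simp

/-- The combination `g τ l • k - g τ k • l` is orthogonal to `τ`, and its norm is `-2 g(τ,k) g(τ,l)
g(k,l)`. The next two lemmas use the same device. -/
theorem IsLorentzFrame.future_mul_nonneg (he : IsLorentzFrame g e) (hτ : 0 < g τ τ) {k l : V}
    (hk : IsFutureNull g τ k) (hl : IsFutureNull g τ l) : 0 ≤ g k l := by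
  obtain ⟨h1, h2⟩ := hk
  obtain ⟨h3, h4⟩ := hl
  have h := (he.orthogonal_timelike hτ (x := g τ l • k - g τ k • l) (by simp; ring)).1
  simp only [map_sub, map_smul, LinearMap.sub_apply, LinearMap.smul_apply, smul_eq_mul, h1, h3,
    he.comm l k] at h
  have : 0 < g τ l * g τ k := mul_pos h4 h2
  nlinarith

theorem IsLorentzFrame.null_parallel (he : IsLorentzFrame g e) (hτ : 0 < g τ τ) {x y : V}
    (hx : g x x = 0) (hx' : g τ x ≠ 0) (hy : g y y = 0) (hxy : g x y = 0) :
    y = (g τ y / g τ x) • x := by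
  rw [← sub_eq_zero]
  refine (he.orthogonal_timelike hτ ?_).2 ?_
  · simp [hx']
  · simp [hx, hy, hxy, he.comm y x]

theorem IsLorentzFrame.future_of_future (he : IsLorentzFrame g e) (hτ : 0 < g τ τ) {σ k : V}
    (hσ : 0 < g σ σ) (hτσ : 0 < g τ σ) (hk : IsFutureNull g τ k) : IsFutureNull g σ k := by
  obtain ⟨h1, h2⟩ := hk
  refine ⟨h1, ?_⟩
  have h := (he.orthogonal_timelike hτ (x := g τ k • σ - g τ σ • k) (by simp; ring)).1
  simp only [map_sub, map_smul, LinearMap.sub_apply, LinearMap.smul_apply, smul_eq_mul, h1,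
    he.comm k σ] at h
  by_contra! hlt
  have h3 : 0 < g τ k * (g τ k * g σ σ) := by positivity
  nlinarith [mul_nonneg (mul_pos h2 hτσ).le (neg_nonneg.mpr hlt)]

theorem IsOrthochronous.neg_orientation {f : V →ₗ[ℝ] V} (h : IsOrthochronous g τ f) :
    IsOrthochronous g (-τ) f := by
  refine ⟨h.1, fun k hk => ?_⟩
  have hk' : IsFutureNull g τ (-k) := ⟨by simpa using hk.1, by simpa using hk.2⟩
  refine (h.2 _ hk').imp (fun h0 => by simpa using h0) fun h1 => ⟨?_, ?_⟩
  · simpa using h1.1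
  · simpa using h1.2

/-- Replacing `τ` by another timelike vector either keeps the future cone or swaps it with the past
one, and a linear map commutes with the swap. This permits working with `e 0`. -/
theorem IsLorentzFrame.isOrthochronous_congr (he : IsLorentzFrame g e) {σ : V} (hτ : 0 < g τ τ)
    (hσ : 0 < g σ σ) {f : V →ₗ[ℝ] V} (h : IsOrthochronous g τ f) : IsOrthochronous g σ f := by
  have aux : ∀ ρ, 0 < g ρ ρ → 0 < g τ ρ → IsOrthochronous g ρ f := fun ρ hρ hτρ =>
    ⟨h.1, fun k hk => (h.2 k (he.future_of_future hρ hτ (by rwa [he.comm]) hk)).imp_right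
      fun hk' => he.future_of_future hτ hρ hτρ hk'⟩
  rcases lt_trichotomy (g τ σ) 0 with h1 | h1 | h1
  · simpa using (aux (-σ) (by simpa using hσ) (by simpa using h1)).neg_orientation
  · exact absurd (he.orthogonal_timelike hτ h1).1 (not_le.mpr hσ)
  · exact aux σ hσ h1

/-- The image of `k` is null, so if it is also orthogonal to `τ` it vanishes; weak positivity
therefore suffices. -/
theorem IsLorentzFrame.isOrthochronous_raise (he : IsLorentzFrame g e) (hτ : 0 < g τ τ)
    {T : BilinForm ℝ V} (hT : IsNullConePreserving g (raise e T))
    (hpos : ∀ k, IsFutureNull g τ k → 0 ≤ T k τ) : IsOrthochronous g τ (raise e T) := by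
  refine ⟨hT, fun k hk => ?_⟩
  have h0 := hT k hk.1
  have h1 : 0 ≤ g τ (raise e T k) := by rw [he.comm, metric_raise he]; exact hpos k hk
  rcases h1.eq_or_lt with h1 | h1
  · exact Or.inl ((he.orthogonal_timelike hτ h1.symm).2 h0)
  · exact Or.inr ⟨h0, h1⟩

/-- A symmetric form that vanishes on the null cone is a multiple of the metric. -/
theorem IsLorentzFrame.eq_smul_of_null [NeZero N] (he : IsLorentzFrame g e) {B : BilinForm ℝ V}
    (hB : ∀ u v, B u v = B v u) (h : ∀ k, g k k = 0 → B k k = 0) : B = B (e 0) (e 0) • g := by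
  have s0 : sgn (0 : Fin N) = 1 := by simp [sgn]
  have si : ∀ i : Fin N, i ≠ 0 → sgn i = -1 := fun i hi => by
    have : (i : ℕ) ≠ 0 := fun h => hi (Fin.ext (by simpa using h))
    simp [sgn, this]
  have h1 : ∀ i : Fin N, i ≠ 0 → B (e 0) (e 0) + B (e i) (e i) = 0 ∧ B (e 0) (e i) = 0 := by
    intro i hi
    -- The sum and difference of the conditions at `e 0 ± e i` separate diagonal and mixed
    -- components.
    have p := h (e 0 + e i) (by simp [he _ _, s0, si i hi, hi, hi.symm])
    have m := h (e 0 - e i) (by simp [he _ _, s0, si i hi, hi, hi.symm])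
    simp only [map_add, map_sub, LinearMap.add_apply, LinearMap.sub_apply, hB (e i) (e 0)] at p m
    constructor <;> linarith
  refine e.ext fun i => e.ext fun j => ?_
  rw [LinearMap.smul_apply, LinearMap.smul_apply, he, smul_eq_mul]
  by_cases hij : i = j
  · subst hij
    by_cases hi : i = 0
    · subst hi; simp [s0]
    · have := (h1 i hi).1
      simp only [if_true, si i hi]; linarith
  · rw [if_neg hij, mul_zero]
    by_cases hi : i = 0
    · subst hi; exact (h1 j (Ne.symm hij)).2
    by_cases hj : j = 0
    · subst hj; rw [hB]; exact (h1 i hi).2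
    -- Null because `3² + 4² = 5²`; the only component not yet known is `B (e i) (e j)`.
    have p := h ((5 : ℝ) • e 0 + (3 : ℝ) • e i + (4 : ℝ) • e j) (by
      simp [he _ _, s0, si i hi, si j hj, hi, hj, hij, Ne.symm hi, Ne.symm hj, Ne.symm hij]
      norm_num)
    simp only [map_add, map_smul, LinearMap.add_apply, LinearMap.smul_apply, smul_eq_mul,
      hB (e i) (e 0), hB (e j) (e 0), hB (e j) (e i), (h1 i hi).2, (h1 j hj).2] at p
    linarith [(h1 i hi).1, (h1 j hj).1]

theorem raise_self_adjoint (he : IsLorentzFrame g e) {T : BilinForm ℝ V} (hT : T.IsSymm) (u v : V) :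
    g (raise e T u) v = g u (raise e T v) := by
  rw [metric_raise he, he.comm, metric_raise he, hT.eq]

/-- A symmetric null-cone preserving map is a conformal map whose square is a scalar. -/
theorem exists_raise_sq (hN : 2 ≤ N) (he : IsLorentzFrame g e) (hτ : 0 < g τ τ) {T : BilinForm ℝ V}
    (hT : T.IsSymm) (h : IsOrthochronous g τ (raise e T)) :
    ∃ l : ℝ, 0 ≤ l ∧ (∀ u v, g (raise e T u) (raise e T v) = l * g u v) ∧
      ∀ u, raise e T (raise e T u) = l • u := by
  have : NeZero N := ⟨by omega⟩
  set f := raise e T with hf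
  have hB := he.eq_smul_of_null (B := g.compl₁₂ f f) (fun u v => he.comm _ _) (fun k hk => h.1 k hk)
  set l := g.compl₁₂ f f (e 0) (e 0)
  have h1 : ∀ u v, g (f u) (f v) = l * g u v := fun u v =>
    LinearMap.congr_fun (LinearMap.congr_fun hB u) v
  refine ⟨l, ?_, h1, fun u => he.eq_of_forall fun w => ?_⟩
  · have s0 : sgn (0 : Fin N) = 1 := by simp [sgn]
    have s1 : sgn (⟨1, hN⟩ : Fin N) = -1 := by simp [sgn]
    have hne : (⟨1, hN⟩ : Fin N) ≠ 0 := fun h => by simpa using congrArg Fin.val h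
    have h0 := he.isOrthochronous_congr (σ := e 0) hτ (by simp [he _ _, s0]) h
    have ht : 0 < g (e 0) (e 0) := by simp [he _ _, s0]
    have p : IsFutureNull g (e 0) (e 0 + e ⟨1, hN⟩) := by
      constructor <;> simp [he _ _, s0, s1, hne, hne.symm]
    have m : IsFutureNull g (e 0) (e 0 - e ⟨1, hN⟩) := by
      constructor <;> simp [he _ _, s0, s1, hne, hne.symm]
    -- The two null vectors have product `2`, so their images have product `2 * l`.
    have hpm : 0 ≤ g (f (e 0 + e ⟨1, hN⟩)) (f (e 0 - e ⟨1, hN⟩)) := by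
      rcases h0.2 _ p with h2 | h2
      · rw [h2]; simp
      rcases h0.2 _ m with h3 | h3
      · rw [h3]; simp
      exact he.future_mul_nonneg ht h2 h3
    rw [h1] at hpm
    simp [he _ _, s0, s1, hne, hne.symm] at hpm
    linarith
  · rw [hf, raise_self_adjoint he hT, ← hf, h1]; simp

end Geometry

/-! ### Contractions and determinants in frame components -/

section Components

variable {V : Type*} [AddCommGroup V] [Module ℝ V] {N : ℕ} {g : BilinForm ℝ V}
  {e : Module.Basis (Fin N) ℝ V}

theorem sum_fin_succ_fun {α : Type*} [Fintype α] {k : ℕ} (f : (Fin (k + 1) → α) → ℝ) :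
    ∑ c, f c = ∑ a, ∑ c : Fin k → α, f (Matrix.vecCons a c) := by
  rw [← Fintype.sum_prod_type' (f := fun a c => f (Matrix.vecCons a c))]
  exact (Fintype.sum_equiv (Fin.consEquiv fun _ => α) _ _ fun _ => rfl).symm

theorem comp_vecCons {α β : Type*} {k : ℕ} (f : α → β) (a : α) (c : Fin k → α) :
    (fun i => f (Matrix.vecCons a c i)) = Matrix.vecCons (f a) fun i => f (c i) := by
  funext i
  refine Fin.cases ?_ (fun _ => ?_) i <;> rfl

theorem comp_vecEmpty {α β : Type*} (f : α → β) (c : Fin 0 → α) : (fun i => f (c i)) = ![] :=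
  Subsingleton.elim _ _

theorem semiSquare_apply_vecCons (e : Module.Basis (Fin N) ℝ V) {k : ℕ}
    (A : V [⋀^Fin (k + 1)]→ₗ[ℝ] ℝ) (u v : V) :
    semiSquare e A u v = (-1) ^ k / (k.factorial : ℝ) * ∑ c : Fin k → Fin N, (∏ i, sgn (c i)) *
      (A (Matrix.vecCons u (fun i => e (c i))) * A (Matrix.vecCons v (fun i => e (c i)))) :=
  rfl

theorem semiSquare_one (e : Module.Basis (Fin N) ℝ V) (A : V [⋀^Fin 1]→ₗ[ℝ] ℝ) (u v : V) :
    semiSquare e A u v = A ![u] * A ![v] := by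
  simp only [semiSquare_apply_vecCons, comp_vecEmpty, Fin.prod_univ_zero]
  norm_num

theorem semiSquare_two (e : Module.Basis (Fin N) ℝ V) (A : V [⋀^Fin 2]→ₗ[ℝ] ℝ) (u v : V) :
    semiSquare e A u v = -∑ c, sgn c * (A ![u, e c] * A ![v, e c]) := by
  simp only [semiSquare_apply_vecCons, sum_fin_succ_fun, comp_vecEmpty,
    comp_vecCons, Fin.prod_univ_one, Matrix.cons_val_zero]
  norm_num

theorem semiSquare_three (e : Module.Basis (Fin N) ℝ V) (A : V [⋀^Fin 3]→ₗ[ℝ] ℝ) (u v : V) :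
    semiSquare e A u v =
      1 / 2 * ∑ c, ∑ d, sgn c * sgn d * (A ![u, e c, e d] * A ![v, e c, e d]) := by
  simp only [semiSquare_apply_vecCons, sum_fin_succ_fun, comp_vecEmpty,
    comp_vecCons, Fin.prod_univ_two, Matrix.cons_val_zero, Matrix.cons_val_one]
  norm_num [Nat.factorial]

theorem hodgeDual_apply (e : Module.Basis (Fin N) ℝ V) {p q : ℕ} (h : p + q = N)
    (Ω : V [⋀^Fin p]→ₗ[ℝ] ℝ) (v : Fin q → V) :
    hodgeDual e h Ω v = (p.factorial : ℝ)⁻¹ * ∑ c : Fin p → Fin N,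
      (∏ i, sgn (c i)) * Ω (fun i => e (c i)) *
        e.det (fun s => Sum.elim (fun i => e (c i)) v (splitSlots h s)) := by
  have hs : ∀ (s : Finset (Fin p → Fin N)) (F : (Fin p → Fin N) → V [⋀^Fin q]→ₗ[ℝ] ℝ),
      (∑ c ∈ s, F c) v = ∑ c ∈ s, F c v := fun s F => by
    induction s using Finset.cons_induction with
    | empty => simp
    | cons a s ha ih => rw [Finset.sum_cons, AlternatingMap.add_apply, ih, Finset.sum_cons]
  rw [hodgeDual, AlternatingMap.smul_apply, hs, smul_eq_mul]
  rfl

theorem hodgeDual_one (e : Module.Basis (Fin N) ℝ V) {q : ℕ} (h : 1 + q = N)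
    (Ω : V [⋀^Fin 1]→ₗ[ℝ] ℝ) (v : Fin q → V) :
    hodgeDual e h Ω v =
      ∑ a, sgn a * Ω ![e a] * e.det (fun s => Sum.elim ![e a] v (splitSlots h s)) := by
  simp only [hodgeDual_apply, sum_fin_succ_fun, comp_vecEmpty, comp_vecCons,
    Fin.prod_univ_one, Matrix.cons_val_zero]
  norm_num

theorem hodgeDual_two (e : Module.Basis (Fin N) ℝ V) {q : ℕ} (h : 2 + q = N)
    (Ω : V [⋀^Fin 2]→ₗ[ℝ] ℝ) (v : Fin q → V) :
    hodgeDual e h Ω v = 1 / 2 * ∑ a, ∑ b, sgn a * sgn b * Ω ![e a, e b] *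
      e.det (fun s => Sum.elim ![e a, e b] v (splitSlots h s)) := by
  simp only [hodgeDual_apply, sum_fin_succ_fun, comp_vecEmpty, comp_vecCons,
    Fin.prod_univ_two, Matrix.cons_val_zero, Matrix.cons_val_one]
  norm_num

theorem hodgeDual_three (e : Module.Basis (Fin N) ℝ V) {q : ℕ} (h : 3 + q = N)
    (Ω : V [⋀^Fin 3]→ₗ[ℝ] ℝ) (v : Fin q → V) :
    hodgeDual e h Ω v = 1 / 6 * ∑ a, ∑ b, ∑ c, sgn a * sgn b * sgn c * Ω ![e a, e b, e c] *
      e.det (fun s => Sum.elim ![e a, e b, e c] v (splitSlots h s)) := by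
  simp only [hodgeDual_apply, sum_fin_succ_fun, comp_vecEmpty, comp_vecCons,
    Fin.prod_univ_three, Matrix.cons_val_zero, Matrix.cons_val_one, Matrix.cons_val]
  norm_num [Nat.factorial]

/-- The frame determinant is that of a 0-1 matrix, which reselects the nodes of a Vandermonde
matrix. The Levi-Civita symbol thus becomes a polynomial in the indices. The denominators `2` and
`12` below are the Vandermonde determinants of `0, 1, 2` and `0, 1, 2, 3`. -/
theorem det_mul_vandermonde (e : Module.Basis (Fin N) ℝ V) (d : Fin N → Fin N) :
    e.det (fun i => e (d i)) * (Matrix.vandermonde fun i : Fin N => (i : ℝ)).det =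
      (Matrix.vandermonde fun i => (d i : ℝ)).det := by
  rw [e.det_apply, ← Matrix.det_transpose, ← Matrix.det_mul]
  congr 1
  ext i j
  rw [Matrix.mul_apply, Finset.sum_eq_single (d i)]
  · simp [Module.Basis.toMatrix_apply, Matrix.vandermonde_apply]
  · intro l _ hl
    simp [Module.Basis.toMatrix_apply, Finsupp.single_eq_of_ne hl]
  · simp

theorem det_frame_two (e : Module.Basis (Fin 2) ℝ V) (i j : Fin 2) :
    e.det ![e i, e j] = (j : ℝ) - i := by
  have h := det_mul_vandermonde e ![i, j]
  simp only [comp_vecCons, comp_vecEmpty, Matrix.det_vandermonde] at h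
  simpa [Fin.prod_univ_succ, Fin.prod_Ioi_succ, Fin.prod_Ioi_zero] using h

theorem det_frame_three (e : Module.Basis (Fin 3) ℝ V) (i j k : Fin 3) :
    e.det ![e i, e j, e k] = ((j : ℝ) - i) * (k - i) * (k - j) / 2 := by
  have h := det_mul_vandermonde e ![i, j, k]
  simp only [comp_vecCons, comp_vecEmpty, Matrix.det_vandermonde] at h
  simp [Fin.prod_univ_succ, Fin.prod_Ioi_succ] at h
  norm_num at h
  linarith

theorem det_frame_four (e : Module.Basis (Fin 4) ℝ V) (i j k l : Fin 4) :
    e.det ![e i, e j, e k, e l] =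
      ((j : ℝ) - i) * (k - i) * (l - i) * (k - j) * (l - j) * (l - k) / 12 := by
  have h := det_mul_vandermonde e ![i, j, k, l]
  simp only [comp_vecCons, comp_vecEmpty, Matrix.det_vandermonde] at h
  simp [Fin.prod_univ_succ, Fin.prod_Ioi_succ] at h
  norm_num at h
  linarith

theorem slots_one_one {α : Type*} {h : 1 + 1 = 2} (a b : α) :
    (fun s => Sum.elim ![a] ![b] (splitSlots h s)) = ![a, b] := by
  funext s; fin_cases s <;> rfl

theorem slots_one_two {α : Type*} {h : 1 + 2 = 3} (a b c : α) :
    (fun s => Sum.elim ![a] ![b, c] (splitSlots h s)) = ![a, b, c] := by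
  funext s; fin_cases s <;> rfl

theorem slots_two_one {α : Type*} {h : 2 + 1 = 3} (a b c : α) :
    (fun s => Sum.elim ![a, b] ![c] (splitSlots h s)) = ![a, b, c] := by
  funext s; fin_cases s <;> rfl

theorem slots_one_three {α : Type*} {h : 1 + 3 = 4} (a b c d : α) :
    (fun s => Sum.elim ![a] ![b, c, d] (splitSlots h s)) = ![a, b, c, d] := by
  funext s; fin_cases s <;> rfl

theorem slots_two_two {α : Type*} {h : 2 + 2 = 4} (a b c d : α) :
    (fun s => Sum.elim ![a, b] ![c, d] (splitSlots h s)) = ![a, b, c, d] := by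
  funext s; fin_cases s <;> rfl

theorem slots_three_one {α : Type*} {h : 3 + 1 = 4} (a b c d : α) :
    (fun s => Sum.elim ![a, b, c] ![d] (splitSlots h s)) = ![a, b, c, d] := by
  funext s; fin_cases s <;> rfl

theorem map_two_eq_zero (A : V [⋀^Fin 2]→ₗ[ℝ] ℝ) (u : V) : A ![u, u] = 0 :=
  A.map_eq_zero_of_eq _ (i := 0) (j := 1) rfl (by decide)

theorem map_two_swap (A : V [⋀^Fin 2]→ₗ[ℝ] ℝ) (u v : V) : A ![v, u] = -A ![u, v] := by
  rw [← A.map_swap ![u, v] (i := 0) (j := 1) (by decide)]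
  congr 1
  funext s; fin_cases s <;> rfl

theorem map_three_eq_zero (A : V [⋀^Fin 3]→ₗ[ℝ] ℝ) (u v : V) :
    A ![u, u, v] = 0 ∧ A ![u, v, u] = 0 ∧ A ![v, u, u] = 0 :=
  ⟨A.map_eq_zero_of_eq _ (i := 0) (j := 1) rfl (by decide),
    A.map_eq_zero_of_eq _ (i := 0) (j := 2) rfl (by decide),
    A.map_eq_zero_of_eq _ (i := 1) (j := 2) rfl (by decide)⟩

theorem map_three_perm (A : V [⋀^Fin 3]→ₗ[ℝ] ℝ) (u v w : V) :
    A ![v, u, w] = -A ![u, v, w] ∧ A ![u, w, v] = -A ![u, v, w] ∧ A ![w, v, u] = -A ![u, v, w] ∧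
      A ![v, w, u] = A ![u, v, w] ∧ A ![w, u, v] = A ![u, v, w] := by
  have h1 : ∀ u v w, A ![v, u, w] = -A ![u, v, w] := fun u v w => by
    rw [← A.map_swap ![u, v, w] (i := 0) (j := 1) (by decide)]
    congr 1
    funext s; fin_cases s <;> rfl
  have h2 : ∀ u v w, A ![u, w, v] = -A ![u, v, w] := fun u v w => by
    rw [← A.map_swap ![u, v, w] (i := 1) (j := 2) (by decide)]
    congr 1
    funext s; fin_cases s <;> rfl
  refine ⟨h1 u v w, h2 u v w, ?_, ?_, ?_⟩
  · rw [h1, h2, h1, neg_neg]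
  · rw [h2, h1, neg_neg]
  · rw [h1, h2, neg_neg]

end Components

/-! ### Hodge duals and squares in dimensions two, three and four -/

section Formulas

variable {V : Type*} [AddCommGroup V] [Module ℝ V] {g : BilinForm ℝ V}

theorem sgn_two : sgn (0 : Fin 2) = 1 ∧ sgn (1 : Fin 2) = -1 := by simp [sgn]

theorem sgn_three : sgn (0 : Fin 3) = 1 ∧ sgn (1 : Fin 3) = -1 ∧ sgn (2 : Fin 3) = -1 := by
  simp [sgn]

theorem sgn_four :
    sgn (0 : Fin 4) = 1 ∧ sgn (1 : Fin 4) = -1 ∧ sgn (2 : Fin 4) = -1 ∧ sgn (3 : Fin 4) = -1 := by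
  simp [sgn]

theorem hodgeDual_one_two (e : Module.Basis (Fin 2) ℝ V) (h : 1 + 1 = 2) (A : V [⋀^Fin 1]→ₗ[ℝ] ℝ) :
    hodgeDual e h A ![e 0] = A ![e 1] ∧ hodgeDual e h A ![e 1] = A ![e 0] := by
  simp only [hodgeDual_one, slots_one_one, Fin.sum_univ_two, det_frame_two, sgn_two.1, sgn_two.2]
  norm_num

theorem hodgeDual_one_three (e : Module.Basis (Fin 3) ℝ V) (h : 1 + 2 = 3)
    (A : V [⋀^Fin 1]→ₗ[ℝ] ℝ) :
    hodgeDual e h A ![e 0, e 1] = -A ![e 2] ∧ hodgeDual e h A ![e 0, e 2] = A ![e 1] ∧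
      hodgeDual e h A ![e 1, e 2] = A ![e 0] := by
  simp only [hodgeDual_one, slots_one_two, Fin.sum_univ_three, det_frame_three, sgn_three.1,
    sgn_three.2.1, sgn_three.2.2]
  norm_num

theorem hodgeDual_two_three (e : Module.Basis (Fin 3) ℝ V) (h : 2 + 1 = 3)
    (A : V [⋀^Fin 2]→ₗ[ℝ] ℝ) :
    hodgeDual e h A ![e 0] = A ![e 1, e 2] ∧ hodgeDual e h A ![e 1] = A ![e 0, e 2] ∧
      hodgeDual e h A ![e 2] = -A ![e 0, e 1] := by
  simp only [hodgeDual_two, slots_two_one, Fin.sum_univ_three, det_frame_three, sgn_three.1,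
    sgn_three.2.1, sgn_three.2.2, map_two_eq_zero, map_two_swap A (e 0) (e 1),
    map_two_swap A (e 0) (e 2), map_two_swap A (e 1) (e 2)]
  norm_num
  refine ⟨?_, ?_, ?_⟩ <;> ring

theorem hodgeDual_one_four (e : Module.Basis (Fin 4) ℝ V) (h : 1 + 3 = 4)
    (A : V [⋀^Fin 1]→ₗ[ℝ] ℝ) :
    hodgeDual e h A ![e 0, e 1, e 2] = A ![e 3] ∧ hodgeDual e h A ![e 0, e 1, e 3] = -A ![e 2] ∧
      hodgeDual e h A ![e 0, e 2, e 3] = A ![e 1] ∧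
      hodgeDual e h A ![e 1, e 2, e 3] = A ![e 0] := by
  simp only [hodgeDual_one, slots_one_three, Fin.sum_univ_four, det_frame_four, sgn_four.1,
    sgn_four.2.1, sgn_four.2.2.1, sgn_four.2.2.2]
  norm_num

theorem hodgeDual_two_four (e : Module.Basis (Fin 4) ℝ V) (h : 2 + 2 = 4)
    (A : V [⋀^Fin 2]→ₗ[ℝ] ℝ) :
    hodgeDual e h A ![e 0, e 1] = A ![e 2, e 3] ∧ hodgeDual e h A ![e 0, e 2] = -A ![e 1, e 3] ∧
      hodgeDual e h A ![e 0, e 3] = A ![e 1, e 2] ∧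
      hodgeDual e h A ![e 1, e 2] = -A ![e 0, e 3] ∧
      hodgeDual e h A ![e 1, e 3] = A ![e 0, e 2] ∧
      hodgeDual e h A ![e 2, e 3] = -A ![e 0, e 1] := by
  simp only [hodgeDual_two, slots_two_two, Fin.sum_univ_four, det_frame_four, sgn_four.1,
    sgn_four.2.1, sgn_four.2.2.1, sgn_four.2.2.2, map_two_eq_zero, map_two_swap A (e 0) (e 1),
    map_two_swap A (e 0) (e 2), map_two_swap A (e 0) (e 3), map_two_swap A (e 1) (e 2),
    map_two_swap A (e 1) (e 3), map_two_swap A (e 2) (e 3)]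
  norm_num
  refine ⟨?_, ?_, ?_, ?_, ?_, ?_⟩ <;> ring

theorem hodgeDual_three_four (e : Module.Basis (Fin 4) ℝ V) (h : 3 + 1 = 4)
    (A : V [⋀^Fin 3]→ₗ[ℝ] ℝ) :
    hodgeDual e h A ![e 0] = A ![e 1, e 2, e 3] ∧ hodgeDual e h A ![e 1] = A ![e 0, e 2, e 3] ∧
      hodgeDual e h A ![e 2] = -A ![e 0, e 1, e 3] ∧
      hodgeDual e h A ![e 3] = A ![e 0, e 1, e 2] := by
  obtain ⟨a1, a2, a3, a4, a5⟩ := map_three_perm A (e 0) (e 1) (e 2)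
  obtain ⟨b1, b2, b3, b4, b5⟩ := map_three_perm A (e 0) (e 1) (e 3)
  obtain ⟨c1, c2, c3, c4, c5⟩ := map_three_perm A (e 0) (e 2) (e 3)
  obtain ⟨d1, d2, d3, d4, d5⟩ := map_three_perm A (e 1) (e 2) (e 3)
  simp only [hodgeDual_three, slots_three_one, Fin.sum_univ_four, det_frame_four, sgn_four.1,
    sgn_four.2.1, sgn_four.2.2.1, sgn_four.2.2.2, (map_three_eq_zero A _ _).1,
    (map_three_eq_zero A _ _).2.1, (map_three_eq_zero A _ _).2.2,
    a1, a2, a3, a4, a5, b1, b2, b3, b4, b5, c1, c2, c3, c4, c5, d1, d2, d3, d4, d5]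
  norm_num
  refine ⟨?_, ?_, ?_, ?_⟩ <;> ring

theorem ext_frame {N : ℕ} (e : Module.Basis (Fin N) ℝ V) {S T : BilinForm ℝ V}
    (h : ∀ i j, S (e i) (e j) = T (e i) (e j)) : S = T :=
  e.ext fun i => e.ext fun j => h i j

/-- The one-form of an alternating map with one argument. -/
def toDual (A : V [⋀^Fin 1]→ₗ[ℝ] ℝ) : Module.Dual ℝ V :=
  A.toMultilinearMap.toLinearMap ![0] 0

theorem toDual_apply (A : V [⋀^Fin 1]→ₗ[ℝ] ℝ) (v : V) : toDual A v = A ![v] := by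
  change A _ = A _
  congr 1
  funext i; fin_cases i; simp

/-- The superenergy tensor of a one-form. -/
noncomputable def dualSuperenergy {N : ℕ} (g : BilinForm ℝ V) (e : Module.Basis (Fin N) ℝ V)
    (ω : Module.Dual ℝ V) : BilinForm ℝ V :=
  ω.smulRight ω - (1 / 2 * ∑ i, sgn i * ω (e i) ^ 2 : ℝ) • g

theorem dualSuperenergy_apply {N : ℕ} (g : BilinForm ℝ V) (e : Module.Basis (Fin N) ℝ V)
    (ω : Module.Dual ℝ V) (u v : V) :
    dualSuperenergy g e ω u v = ω u * ω v - 1 / 2 * (∑ i, sgn i * ω (e i) ^ 2) * g u v := by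
  simp [dualSuperenergy]

/-- Here and in the next two lemmas, `A` is an `(N - 1)`-form related to `ω` by duality. Expressing
the duality by components covers both `A = *ω` and `ω = *A`, without sign rules for `**`. -/
theorem semiSquare_one_dim_two {e : Module.Basis (Fin 2) ℝ V} (he : IsLorentzFrame g e)
    {A : V [⋀^Fin 1]→ₗ[ℝ] ℝ} {ω : Module.Dual ℝ V} (h0 : A ![e 1] = ω (e 0))
    (h1 : A ![e 0] = ω (e 1)) :
    semiSquare e A = ω.smulRight ω - (∑ i, sgn i * ω (e i) ^ 2 : ℝ) • g := by
  refine ext_frame e fun i j => ?_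
  simp only [semiSquare_one, LinearMap.sub_apply, LinearMap.smulRight_apply, LinearMap.smul_apply,
    smul_eq_mul, he i j, Fin.sum_univ_two, sgn_two.1, sgn_two.2]
  fin_cases i <;> fin_cases j <;> simp [h0, h1, sgn_two] <;> ring

theorem semiSquare_two_dim_three {e : Module.Basis (Fin 3) ℝ V} (he : IsLorentzFrame g e)
    {A : V [⋀^Fin 2]→ₗ[ℝ] ℝ} {ω : Module.Dual ℝ V} (h0 : A ![e 1, e 2] = ω (e 0))
    (h1 : A ![e 0, e 2] = ω (e 1)) (h2 : A ![e 0, e 1] = -ω (e 2)) :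
    semiSquare e A = ω.smulRight ω - (∑ i, sgn i * ω (e i) ^ 2 : ℝ) • g := by
  have a := map_two_swap A (e 0) (e 1)
  have b := map_two_swap A (e 0) (e 2)
  have c := map_two_swap A (e 1) (e 2)
  refine ext_frame e fun i j => ?_
  simp only [semiSquare_two, LinearMap.sub_apply, LinearMap.smulRight_apply, LinearMap.smul_apply,
    smul_eq_mul, he i j, Fin.sum_univ_three, sgn_three.1, sgn_three.2.1, sgn_three.2.2]
  fin_cases i <;> fin_cases j <;>
    simp [map_two_eq_zero, a, b, c, h0, h1, h2, sgn_three] <;> ring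

theorem semiSquare_three_dim_four {e : Module.Basis (Fin 4) ℝ V} (he : IsLorentzFrame g e)
    {A : V [⋀^Fin 3]→ₗ[ℝ] ℝ} {ω : Module.Dual ℝ V} (h0 : A ![e 1, e 2, e 3] = ω (e 0))
    (h1 : A ![e 0, e 2, e 3] = ω (e 1)) (h2 : A ![e 0, e 1, e 3] = -ω (e 2))
    (h3 : A ![e 0, e 1, e 2] = ω (e 3)) :
    semiSquare e A = ω.smulRight ω - (∑ i, sgn i * ω (e i) ^ 2 : ℝ) • g := by
  obtain ⟨a1, a2, a3, a4, a5⟩ := map_three_perm A (e 0) (e 1) (e 2)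
  obtain ⟨b1, b2, b3, b4, b5⟩ := map_three_perm A (e 0) (e 1) (e 3)
  obtain ⟨c1, c2, c3, c4, c5⟩ := map_three_perm A (e 0) (e 2) (e 3)
  obtain ⟨d1, d2, d3, d4, d5⟩ := map_three_perm A (e 1) (e 2) (e 3)
  refine ext_frame e fun i j => ?_
  simp only [semiSquare_three, LinearMap.sub_apply, LinearMap.smulRight_apply, LinearMap.smul_apply,
    smul_eq_mul, he i j, Fin.sum_univ_four, sgn_four.1, sgn_four.2.1, sgn_four.2.2.1,
    sgn_four.2.2.2]
  fin_cases i <;> fin_cases j <;>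
    simp [(map_three_eq_zero A _ _).1, (map_three_eq_zero A _ _).2.1,
      (map_three_eq_zero A _ _).2.2, a1, a2, a3, a4, a5, b1, b2, b3, b4, b5, c1, c2, c3, c4, c5,
      d1, d2, d3, d4, d5, h0, h1, h2, h3, sgn_four] <;> ring

end Formulas

/-! ### Superenergy tensors by degree -/

section SuperenergyTensors

variable {V : Type*} [AddCommGroup V] [Module ℝ V] {N : ℕ} {g : BilinForm ℝ V}

theorem half_smul_eq_dualSuperenergy {e : Module.Basis (Fin N) ℝ V} (ω : Module.Dual ℝ V) :
    (1 / 2 : ℝ) • (ω.smulRight ω + (ω.smulRight ω - (∑ i, sgn i * ω (e i) ^ 2 : ℝ) • g)) =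
      dualSuperenergy g e ω := by
  refine ext_frame e fun i j => ?_
  rw [dualSuperenergy_apply]
  simp
  ring

theorem semiSquare_one_eq (e : Module.Basis (Fin N) ℝ V) (Ω : V [⋀^Fin 1]→ₗ[ℝ] ℝ) :
    semiSquare e Ω = (toDual Ω).smulRight (toDual Ω) := by
  refine ext_frame e fun i j => ?_
  simp [semiSquare_one, toDual_apply]

theorem superenergy_one {e : Module.Basis (Fin N) ℝ V} (he : IsLorentzFrame g e) (hN : N ≤ 4)
    {q : ℕ} (h : 0 + 1 + (q + 1) = N) (Ω : V [⋀^Fin 1]→ₗ[ℝ] ℝ) :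
    superenergy g e h Ω = dualSuperenergy g e (toDual Ω) := by
  have hq : q = 0 ∨ q = 1 ∨ q = 2 := by omega
  rw [← half_smul_eq_dualSuperenergy]
  change (1 / 2 : ℝ) • (_ + _) = _
  rw [semiSquare_one_eq]
  congr 2
  rcases hq with rfl | rfl | rfl
  · have hN' : 2 = N := h
    subst hN'
    obtain ⟨h0, h1⟩ := hodgeDual_one_two e h Ω
    exact semiSquare_one_dim_two he (h1.trans (toDual_apply _ _).symm)
      (h0.trans (toDual_apply _ _).symm)
  · have hN' : 3 = N := h
    subst hN'
    obtain ⟨h0, h1, h2⟩ := hodgeDual_one_three e h Ω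
    exact semiSquare_two_dim_three he (h2.trans (toDual_apply _ _).symm)
      (h1.trans (toDual_apply _ _).symm) (h0.trans (by rw [toDual_apply]))
  · have hN' : 4 = N := h
    subst hN'
    obtain ⟨h0, h1, h2, h3⟩ := hodgeDual_one_four e h Ω
    exact semiSquare_three_dim_four he (h3.trans (toDual_apply _ _).symm)
      (h2.trans (toDual_apply _ _).symm) (h1.trans (by rw [toDual_apply]))
      (h0.trans (toDual_apply _ _).symm)

theorem toDual_eq_zero {Ω : V [⋀^Fin 1]→ₗ[ℝ] ℝ} (h : toDual Ω = 0) : Ω = 0 := by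
  ext v
  rw [show v = ![v 0] by funext i; fin_cases i; rfl, ← toDual_apply, h]
  rfl

theorem map_two_frame_eq_zero {e : Module.Basis (Fin N) ℝ V} {A : V [⋀^Fin 2]→ₗ[ℝ] ℝ}
    (h : ∀ i j, A ![e i, e j] = 0) : A = 0 := by
  refine e.ext_alternating fun v _ => ?_
  rw [show (fun i => e (v i)) = ![e (v 0), e (v 1)] by funext i; fin_cases i <;> rfl, h]
  rfl

theorem map_three_frame_eq_zero {e : Module.Basis (Fin N) ℝ V} {A : V [⋀^Fin 3]→ₗ[ℝ] ℝ}
    (h : ∀ i j k, A ![e i, e j, e k] = 0) : A = 0 := by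
  refine e.ext_alternating fun v _ => ?_
  rw [show (fun i => e (v i)) = ![e (v 0), e (v 1), e (v 2)] by funext i; fin_cases i <;> rfl, h]
  rfl

theorem semiSquare_two_eq_hodgeDual {e : Module.Basis (Fin 3) ℝ V} (he : IsLorentzFrame g e)
    (h : 2 + 1 = 3) (Ω : V [⋀^Fin 2]→ₗ[ℝ] ℝ) {ω : Module.Dual ℝ V}
    (hω : ω = toDual (hodgeDual e h Ω)) :
    semiSquare e Ω = ω.smulRight ω - (∑ i, sgn i * ω (e i) ^ 2 : ℝ) • g ∧ (ω = 0 → Ω = 0) := by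
  obtain ⟨h0, h1, h2⟩ := hodgeDual_two_three e h Ω
  rw [← toDual_apply, ← hω] at h0 h1 h2
  replace h2 : Ω ![e 0, e 1] = -ω (e 2) := by rw [h2, neg_neg]
  refine ⟨semiSquare_two_dim_three he h0.symm h1.symm h2, fun hz => ?_⟩
  rw [hz] at h0 h1 h2
  refine map_two_frame_eq_zero (e := e) fun i j => ?_
  have a := map_two_swap Ω (e 0) (e 1)
  have b := map_two_swap Ω (e 0) (e 2)
  have c := map_two_swap Ω (e 1) (e 2)
  fin_cases i <;> fin_cases j <;> simp [map_two_eq_zero, a, b, c, ← h0, ← h1, h2]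

theorem semiSquare_three_eq_hodgeDual {e : Module.Basis (Fin 4) ℝ V} (he : IsLorentzFrame g e)
    (h : 3 + 1 = 4) (Ω : V [⋀^Fin 3]→ₗ[ℝ] ℝ) {ω : Module.Dual ℝ V}
    (hω : ω = toDual (hodgeDual e h Ω)) :
    semiSquare e Ω = ω.smulRight ω - (∑ i, sgn i * ω (e i) ^ 2 : ℝ) • g ∧ (ω = 0 → Ω = 0) := by
  obtain ⟨h0, h1, h2, h3⟩ := hodgeDual_three_four e h Ω
  rw [← toDual_apply, ← hω] at h0 h1 h2 h3
  replace h2 : Ω ![e 0, e 1, e 3] = -ω (e 2) := by rw [h2, neg_neg]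
  refine ⟨semiSquare_three_dim_four he h0.symm h1.symm h2 h3.symm, fun hz => ?_⟩
  rw [hz] at h0 h1 h2 h3
  obtain ⟨a1, a2, a3, a4, a5⟩ := map_three_perm Ω (e 0) (e 1) (e 2)
  obtain ⟨b1, b2, b3, b4, b5⟩ := map_three_perm Ω (e 0) (e 1) (e 3)
  obtain ⟨c1, c2, c3, c4, c5⟩ := map_three_perm Ω (e 0) (e 2) (e 3)
  obtain ⟨d1, d2, d3, d4, d5⟩ := map_three_perm Ω (e 1) (e 2) (e 3)
  refine map_three_frame_eq_zero (e := e) fun i j k => ?_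
  fin_cases i <;> fin_cases j <;> fin_cases k <;>
    simp [(map_three_eq_zero Ω _ _).1, (map_three_eq_zero Ω _ _).2.1,
      (map_three_eq_zero Ω _ _).2.2, a1, a2, a3, a4, a5, b1, b2, b3, b4, b5, c1, c2, c3, c4, c5,
      d1, d2, d3, d4, d5, ← h0, ← h1, h2, ← h3]

/-- The superenergy tensor of a form of degree `1` or `N - 1` is that of a one-form. -/
theorem exists_superenergy_eq_dual {e : Module.Basis (Fin N) ℝ V} (he : IsLorentzFrame g e)
    (hN : N ≤ 4) {k q : ℕ} (h : k + 1 + (q + 1) = N) (hkq : k = 0 ∨ q = 0)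
    (Ω : V [⋀^Fin (k + 1)]→ₗ[ℝ] ℝ) :
    ∃ ω, superenergy g e h Ω = dualSuperenergy g e ω ∧ (ω = 0 → Ω = 0) := by
  by_cases hk : k = 0
  · subst hk
    exact ⟨toDual Ω, superenergy_one he hN h Ω, toDual_eq_zero⟩
  obtain rfl : q = 0 := hkq.resolve_left hk
  refine ⟨toDual (hodgeDual e h Ω), ?_⟩
  -- In degree `N - 1` the dual is the one-form, so the two halves of the superenergy tensor
  -- exchange roles.
  suffices H : semiSquare e Ω = (toDual (hodgeDual e h Ω)).smulRight (toDual (hodgeDual e h Ω)) -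
      (∑ i, sgn i * (toDual (hodgeDual e h Ω)) (e i) ^ 2 : ℝ) • g ∧
      (toDual (hodgeDual e h Ω) = 0 → Ω = 0) by
    refine ⟨?_, H.2⟩
    rw [← half_smul_eq_dualSuperenergy, ← H.1, ← semiSquare_one_eq]
    exact congrArg ((1 / 2 : ℝ) • ·)
      (add_comm (semiSquare e Ω) (semiSquare e (hodgeDual e h Ω)))
  have hk : k = 1 ∨ k = 2 := by omega
  rcases hk with rfl | rfl
  · have hN' : 3 = N := h
    subst hN'
    exact semiSquare_two_eq_hodgeDual he h Ω rfl
  · have hN' : 4 = N := h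
    subst hN'
    exact semiSquare_three_eq_hodgeDual he h Ω rfl

/-- The Maxwell stress tensor: in dimension four `*F ⊙ *F` differs from `F ⊙ F` by `½ F_{ab} F^{ab}
g`. -/
theorem superenergy_two_four {e : Module.Basis (Fin 4) ℝ V} (he : IsLorentzFrame g e)
    (h : 1 + 1 + (1 + 1) = 4) (F : V [⋀^Fin 2]→ₗ[ℝ] ℝ) :
    superenergy g e h F = semiSquare e F +
      (1 / 4 * ∑ a, ∑ b, sgn a * sgn b * F ![e a, e b] ^ 2 : ℝ) • g := by
  obtain ⟨h1, h2, h3, h4, h5, h6⟩ := hodgeDual_two_four e h F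
  have sw := fun (A : V [⋀^Fin 2]→ₗ[ℝ] ℝ) =>
    And.intro (map_two_swap A (e 0) (e 1)) <| And.intro (map_two_swap A (e 0) (e 2)) <|
      And.intro (map_two_swap A (e 0) (e 3)) <| And.intro (map_two_swap A (e 1) (e 2)) <|
      And.intro (map_two_swap A (e 1) (e 3)) (map_two_swap A (e 2) (e 3))
  obtain ⟨a1, a2, a3, a4, a5, a6⟩ := sw F
  obtain ⟨b1, b2, b3, b4, b5, b6⟩ := sw (hodgeDual e h F)
  change (1 / 2 : ℝ) • (semiSquare e F + semiSquare e (hodgeDual e h F)) = _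
  refine ext_frame e fun i j => ?_
  simp only [LinearMap.add_apply, LinearMap.smul_apply, smul_eq_mul, semiSquare_two,
    Fin.sum_univ_four, he i j, sgn_four.1, sgn_four.2.1, sgn_four.2.2.1, sgn_four.2.2.2,
    map_two_eq_zero, a1, a2, a3, a4, a5, a6]
  fin_cases i <;> fin_cases j <;>
    simp [map_two_eq_zero, a1, a2, a3, a4, a5, a6, b1, b2, b3, b4, b5, b6, h1, h2, h3, h4, h5, h6,
      sgn_four] <;> ring

theorem superenergy_zero {e : Module.Basis (Fin N) ℝ V} {k q : ℕ} (h : k + 1 + q = N) :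
    superenergy g e h 0 = 0 := by
  have hs : ∀ j, semiSquare e (0 : V [⋀^Fin (j + 1)]→ₗ[ℝ] ℝ) = 0 := fun j =>
    ext_frame e fun a b => by simp [semiSquare_apply]
  cases q with
  | zero => simp [superenergy]
  | succ q =>
    have hh : hodgeDual e h (0 : V [⋀^Fin (k + 1)]→ₗ[ℝ] ℝ) = 0 := by simp [hodgeDual]
    simp [superenergy, hs, hh]

/-! ### Symmetry, orthochronicity and definiteness -/

theorem dualSuperenergy_isSymm {e : Module.Basis (Fin N) ℝ V} (he : IsLorentzFrame g e)
    (ω : Module.Dual ℝ V) : (dualSuperenergy g e ω).IsSymm := by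
  refine ⟨fun u v => ?_⟩
  simp only [dualSuperenergy_apply, he.comm u v]
  ring

theorem dualSuperenergy_dual {e : Module.Basis (Fin N) ℝ V} (he : IsLorentzFrame g e)
    {ω : Module.Dual ℝ V} {w : V} (hw : ∀ x, ω x = g w x) (u v : V) :
    dualSuperenergy g e ω u v = g w u * g w v - 1 / 2 * g w w * g u v := by
  simp only [dualSuperenergy_apply, hw, pow_two, he.sum_mul]

theorem dualSuperenergy_isOrthochronous {e : Module.Basis (Fin N) ℝ V} (he : IsLorentzFrame g e)
    {τ : V} (hτ : 0 < g τ τ) (ω : Module.Dual ℝ V) :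
    IsOrthochronous g τ (raise e (dualSuperenergy g e ω)) := by
  obtain ⟨w, hw⟩ := he.exists_dual ω
  refine he.isOrthochronous_raise hτ (fun k hk => ?_) fun k ⟨hk, hk'⟩ => ?_
  · have : raise e (dualSuperenergy g e ω) k = g w k • w - (1 / 2 * g w w) • k :=
      he.eq_of_forall fun x => by
        rw [metric_raise he, dualSuperenergy_dual he hw]; simp
    rw [this]
    simp [hk, he.comm k w]
    ring
  · rw [dualSuperenergy_dual he hw, he.comm k τ]
    -- The norm of this vector is `-2 g(τ,k)` times the quantity to be shown nonnegative.
    have h := (he.orthogonal_timelike hτ (x := g τ k • w - g τ w • k) (by simp; ring)).1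
    simp only [map_sub, map_smul, LinearMap.sub_apply, LinearMap.smul_apply, smul_eq_mul, hk,
      he.comm k w] at h
    rw [he.comm w τ]
    by_contra! hlt
    nlinarith

theorem dualSuperenergy_eq_zero {e : Module.Basis (Fin N) ℝ V} (he : IsLorentzFrame g e)
    (hN : 2 ≤ N) {ω : Module.Dual ℝ V} (h : dualSuperenergy g e ω = 0) : ω = 0 := by
  have key : ∀ u v, ω u * ω v = 1 / 2 * (∑ i, sgn i * ω (e i) ^ 2) * g u v := fun u v => by
    rw [← sub_eq_zero, ← dualSuperenergy_apply, h]; rfl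
  set c := ∑ i, sgn i * ω (e i) ^ 2
  have h0 := key (e ⟨0, by omega⟩) (e ⟨0, by omega⟩)
  have h1 := key (e ⟨1, by omega⟩) (e ⟨1, by omega⟩)
  simp only [he _ _, if_true, sgn, one_ne_zero, if_false] at h0 h1
  -- The squares `ω(e₀)² = c / 2` and `ω(e₁)² = -c / 2` are both nonnegative.
  have hc : c = 0 := by
    nlinarith [mul_self_nonneg (ω (e ⟨0, by omega⟩)), mul_self_nonneg (ω (e ⟨1, by omega⟩))]
  ext v
  simpa [hc] using key v v

theorem semiSquare_two_isSymm {e : Module.Basis (Fin N) ℝ V} (F : V [⋀^Fin 2]→ₗ[ℝ] ℝ) :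
    (semiSquare e F).IsSymm := by
  refine ⟨fun u v => ?_⟩
  simp only [semiSquare_two, mul_comm (F ![u, _])]

theorem superenergy_two_four_frame {e : Module.Basis (Fin 4) ℝ V} (he : IsLorentzFrame g e)
    (h : 1 + 1 + (1 + 1) = 4) (F : V [⋀^Fin 2]→ₗ[ℝ] ℝ) (i j : Fin 4) :
    superenergy g e h F (e i) (e j) =
      -(∑ c, sgn c * (F ![e i, e c] * F ![e j, e c])) +
      1 / 4 * (∑ a, ∑ b, sgn a * sgn b * F ![e a, e b] ^ 2) * if i = j then sgn i else 0 := by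
  rw [superenergy_two_four he, ← he i j, ← semiSquare_two]
  simp

/-- Energy density and Poynting vector, with `E = (F₀₁, F₀₂, F₀₃)` and `B = (F₂₃, -F₁₃, F₁₂)`. The
energy density is positive definite in `F`. -/
theorem superenergy_two_four_frame_zero {e : Module.Basis (Fin 4) ℝ V} (he : IsLorentzFrame g e)
    (h : 1 + 1 + (1 + 1) = 4) (F : V [⋀^Fin 2]→ₗ[ℝ] ℝ) :
    superenergy g e h F (e 0) (e 0) =
      1 / 2 * (F ![e 0, e 1] ^ 2 + F ![e 0, e 2] ^ 2 + F ![e 0, e 3] ^ 2 + F ![e 1, e 2] ^ 2 +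
        F ![e 1, e 3] ^ 2 + F ![e 2, e 3] ^ 2) ∧
    superenergy g e h F (e 1) (e 0) =
      F ![e 1, e 2] * F ![e 0, e 2] + F ![e 1, e 3] * F ![e 0, e 3] ∧
    superenergy g e h F (e 2) (e 0) =
      -F ![e 1, e 2] * F ![e 0, e 1] + F ![e 2, e 3] * F ![e 0, e 3] ∧
    superenergy g e h F (e 3) (e 0) =
      -F ![e 1, e 3] * F ![e 0, e 1] - F ![e 2, e 3] * F ![e 0, e 2] := by
  simp [superenergy_two_four_frame he, Fin.sum_univ_four, sgn_four, map_two_eq_zero,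
    map_two_swap F (e 0) (e 1), map_two_swap F (e 0) (e 2), map_two_swap F (e 0) (e 3),
    map_two_swap F (e 1) (e 2), map_two_swap F (e 1) (e 3), map_two_swap F (e 2) (e 3)]
  ring_nf
  simp

theorem superenergy_two_four_eq_zero {e : Module.Basis (Fin 4) ℝ V} (he : IsLorentzFrame g e)
    (h : 1 + 1 + (1 + 1) = 4) {F : V [⋀^Fin 2]→ₗ[ℝ] ℝ} (hF : superenergy g e h F = 0) : F = 0 := by
  have h0 := (superenergy_two_four_frame_zero he h F).1
  rw [hF] at h0
  simp only [LinearMap.zero_apply] at h0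
  have z : F ![e 0, e 1] = 0 ∧ F ![e 0, e 2] = 0 ∧ F ![e 0, e 3] = 0 ∧ F ![e 1, e 2] = 0 ∧
      F ![e 1, e 3] = 0 ∧ F ![e 2, e 3] = 0 := by
    refine ⟨?_, ?_, ?_, ?_, ?_, ?_⟩ <;> refine (pow_eq_zero_iff two_ne_zero).mp ?_ <;> nlinarith
  refine map_two_frame_eq_zero (e := e) fun i j => ?_
  fin_cases i <;> fin_cases j <;> simp [map_two_eq_zero, z,
    map_two_swap F (e 0) (e 1), map_two_swap F (e 0) (e 2), map_two_swap F (e 0) (e 3),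
    map_two_swap F (e 1) (e 2), map_two_swap F (e 1) (e 3), map_two_swap F (e 2) (e 3)]

theorem superenergy_two_four_conformal {e : Module.Basis (Fin 4) ℝ V} (he : IsLorentzFrame g e)
    (h : 1 + 1 + (1 + 1) = 4) (F : V [⋀^Fin 2]→ₗ[ℝ] ℝ) :
    ∃ l : ℝ, g.compl₁₂ (raise e (superenergy g e h F)) (raise e (superenergy g e h F)) = l • g := by
  -- The Rainich scalar `¼ (E² - B²)² + (E · B)²`.
  refine ⟨1 / 4 * (F ![e 0, e 1] ^ 2 + F ![e 0, e 2] ^ 2 + F ![e 0, e 3] ^ 2 - F ![e 1, e 2] ^ 2 -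
    F ![e 1, e 3] ^ 2 - F ![e 2, e 3] ^ 2) ^ 2 + (F ![e 0, e 1] * F ![e 2, e 3] -
    F ![e 0, e 2] * F ![e 1, e 3] + F ![e 0, e 3] * F ![e 1, e 2]) ^ 2, ext_frame e fun i j => ?_⟩
  rw [LinearMap.compl₁₂_apply, ← he.sum_mul, LinearMap.smul_apply, LinearMap.smul_apply, he i j]
  simp only [metric_raise he, superenergy_two_four_frame he, Fin.sum_univ_four, sgn_four.1,
    sgn_four.2.1, sgn_four.2.2.1, sgn_four.2.2.2, map_two_eq_zero, smul_eq_mul,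
    map_two_swap F (e 0) (e 1), map_two_swap F (e 0) (e 2), map_two_swap F (e 0) (e 3),
    map_two_swap F (e 1) (e 2), map_two_swap F (e 1) (e 3), map_two_swap F (e 2) (e 3)]
  fin_cases i <;> fin_cases j <;> simp [sgn_four, map_two_eq_zero,
    map_two_swap F (e 0) (e 1), map_two_swap F (e 0) (e 2), map_two_swap F (e 0) (e 3),
    map_two_swap F (e 1) (e 2), map_two_swap F (e 1) (e 3), map_two_swap F (e 2) (e 3)] <;> ring

theorem superenergy_two_four_isOrthochronous {e : Module.Basis (Fin 4) ℝ V}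
    (he : IsLorentzFrame g e) {τ : V} (hτ : 0 < g τ τ) (h : 1 + 1 + (1 + 1) = 4)
    (F : V [⋀^Fin 2]→ₗ[ℝ] ℝ) : IsOrthochronous g τ (raise e (superenergy g e h F)) := by
  have h0 : 0 < g (e 0) (e 0) := by simp [he _ _, sgn_four]
  refine he.isOrthochronous_congr h0 hτ (he.isOrthochronous_raise h0 (fun k hk => ?_)
    fun k ⟨hk, hk'⟩ => ?_)
  · obtain ⟨l, hl⟩ := superenergy_two_four_conformal he h F
    have := LinearMap.congr_fun (LinearMap.congr_fun hl k) k
    simpa [hk] using this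
  · obtain ⟨t0, t1, t2, t3⟩ := superenergy_two_four_frame_zero he h F
    rw [← he.sum_mul] at hk
    conv_rhs => rw [← he.sum_smul k]
    rw [he.comm] at hk'
    simp only [Fin.sum_univ_four, sgn_four.1, sgn_four.2.1, sgn_four.2.2.1, sgn_four.2.2.2,
      map_add, map_smul, LinearMap.add_apply, LinearMap.smul_apply, smul_eq_mul, t0, t1, t2,
      t3] at hk ⊢
    generalize g k (e 0) = x0 at *
    generalize g k (e 1) = x1 at *
    generalize g k (e 2) = x2 at *
    generalize g k (e 3) = x3 at *
    generalize F ![e 0, e 1] = a at *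
    generalize F ![e 0, e 2] = b at *
    generalize F ![e 0, e 3] = c at *
    generalize F ![e 1, e 2] = p at *
    generalize F ![e 1, e 3] = q at *
    generalize F ![e 2, e 3] = r at *
    -- After multiplication by `x0 > 0`, and using `x0² = |x|²`, the value is `½ (|x0 E + x × B|² +
    -- (x · B)²)`.
    refine nonneg_of_mul_nonneg_right ?_ hk'
    have hs : 0 ≤ (x0 * a + q * x3 + p * x2) ^ 2 + (x0 * b - p * x1 + r * x3) ^ 2 +
      (x0 * c - r * x2 - q * x1) ^ 2 + (r * x1 - q * x2 + p * x3) ^ 2 := by positivity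
    linear_combination 1 / 2 * hs - (1 / 2 * (p ^ 2 + q ^ 2 + r ^ 2)) * hk

end SuperenergyTensors

/-! ### Simple forms and the tensors they realise -/

section Simple

variable {V : Type*} [AddCommGroup V] [Module ℝ V] {N : ℕ} {g : BilinForm ℝ V}

theorem wedge_apply {p : ℕ} (ω : Fin p → Module.Dual ℝ V) (v : Fin p → V) :
    wedge ω v = Matrix.det (Matrix.of fun i j => ω j (v i)) :=
  rfl

/-- A proper range lies in the kernel of a nonzero functional, whose coefficients would be a linear
relation among the `ω i`. -/
theorem pi_surjective_of_linearIndependent {p : ℕ} {ω : Fin p → Module.Dual ℝ V}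
    (h : LinearIndependent ℝ ω) : Function.Surjective (LinearMap.pi ω) := by
  rw [← LinearMap.range_eq_top]
  by_contra hne
  obtain ⟨φ, hφ, hle⟩ := Submodule.exists_le_ker_of_lt_top _ (lt_top_iff_ne_top.mpr hne)
  refine hφ (LinearMap.pi_ext' fun i => LinearMap.ext_ring ?_)
  refine Fintype.linearIndependent_iff.mp h (fun i => φ (Pi.single i 1)) ?_ i
  ext v
  have hv : φ (LinearMap.pi ω v) = 0 := hle ⟨v, rfl⟩
  rw [← LinearMap.sum_single_apply (φ := fun _ : Fin p => ℝ) (LinearMap.pi ω v), map_sum] at hv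
  rw [LinearMap.sum_apply, LinearMap.zero_apply, ← hv]
  refine Finset.sum_congr rfl fun i _ => ?_
  have : (Pi.single i (LinearMap.pi ω v i) : Fin p → ℝ) =
      (ω i v) • (Pi.single i (1 : ℝ) : Fin p → ℝ) := by
    ext j; simp [Pi.single_apply]
  rw [this, map_smul, LinearMap.smul_apply, smul_eq_mul, smul_eq_mul, mul_comm]

/-- On vectors dual to its factors a wedge product is the determinant of the identity matrix. -/
theorem IsSimpleForm.ne_zero {p : ℕ} {Ω : V [⋀^Fin p]→ₗ[ℝ] ℝ} (h : IsSimpleForm Ω) : Ω ≠ 0 := by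
  obtain ⟨ω, hω, rfl⟩ := h
  choose v hv using fun j : Fin p =>
    pi_surjective_of_linearIndependent hω (Pi.single j (1 : ℝ))
  intro h0
  have h1 : wedge ω v = 1 := by
    rw [wedge_apply, ← Matrix.det_one (n := Fin p)]
    congr 1
    ext i j
    have := congrFun (hv i) j
    simpa [Matrix.one_apply, Pi.single_apply, eq_comm] using this
  rw [h0] at h1
  simp at h1

theorem superenergy_eq_zero {e : Module.Basis (Fin N) ℝ V} (he : IsLorentzFrame g e) (hN : 2 ≤ N)
    (hN' : N ≤ 4) {k q : ℕ} (h : k + 1 + q = N) {Ω : V [⋀^Fin (k + 1)]→ₗ[ℝ] ℝ}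
    (h0 : superenergy g e h Ω = 0) : Ω = 0 := by
  cases q with
  | zero =>
    subst h
    have h1 := LinearMap.congr_fun (LinearMap.congr_fun h0 (e 0)) (e 0)
    simp [superenergy, he _ _, sgn] at h1
    exact h1
  | succ q =>
    by_cases hkq : k = 0 ∨ q = 0
    · obtain ⟨ω, h1, h2⟩ := exists_superenergy_eq_dual he hN' h hkq Ω
      exact h2 (dualSuperenergy_eq_zero he hN (h1.symm.trans h0))
    · obtain rfl : k = 1 := by omega
      obtain rfl : q = 1 := by omega
      have hN4 : 4 = N := h
      subst hN4
      exact superenergy_two_four_eq_zero he h h0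

theorem superenergy_isSymm_isOrthochronous {e : Module.Basis (Fin N) ℝ V} (he : IsLorentzFrame g e)
    (hN' : N ≤ 4) {τ : V} (hτ : 0 < g τ τ) {k q : ℕ} (h : k + 1 + q = N)
    (Ω : V [⋀^Fin (k + 1)]→ₗ[ℝ] ℝ) :
    (superenergy g e h Ω).IsSymm ∧ IsOrthochronous g τ (raise e (superenergy g e h Ω)) := by
  cases q with
  | zero =>
    set c : ℝ := 1 / 2 * Ω (fun i => e (Fin.cast h i)) ^ 2 with hc
    have hT : superenergy g e h Ω = c • g := rfl
    rw [hT]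
    have hr : ∀ k, raise e (c • g) k = c • k := fun k =>
      he.eq_of_forall fun x => by rw [metric_raise he]; simp
    refine ⟨⟨fun u v => by simp [he.comm u v]⟩, he.isOrthochronous_raise hτ (fun k hk => ?_)
      fun k hk => ?_⟩
    · simp [hr, hk]
    · have := hk.2
      rw [he.comm] at this
      simp only [LinearMap.smul_apply, smul_eq_mul]
      positivity
  | succ q =>
    by_cases hkq : k = 0 ∨ q = 0
    · obtain ⟨ω, h1, -⟩ := exists_superenergy_eq_dual he hN' h hkq Ω
      rw [h1]
      exact ⟨dualSuperenergy_isSymm he ω, dualSuperenergy_isOrthochronous he hτ ω⟩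
    · obtain rfl : k = 1 := by omega
      obtain rfl : q = 1 := by omega
      have hN4 : 4 = N := h
      subst hN4
      refine ⟨⟨fun u v => ?_⟩, superenergy_two_four_isOrthochronous he hτ h Ω⟩
      rw [superenergy_two_four he h]
      simp [he.comm u v, (semiSquare_two_isSymm (e := e) Ω).eq u v]

theorem dualSuperenergy_mem_SS {e : Module.Basis (Fin N) ℝ V} (he : IsLorentzFrame g e) (hN : 2 ≤ N)
    (hN' : N ≤ 4) {ω : Module.Dual ℝ V} (hω : ω ≠ 0) : dualSuperenergy g e ω ∈ SS g e := by
  -- Writing `N - 2 + 1` for `N - 1` exposes the successor that selects the branch `p < N` of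
  -- `superenergy`.
  refine ⟨0, N - 2 + 1, by omega, wedge fun _ => ω, ⟨_, ?_, rfl⟩, ?_⟩
  · exact (linearIndependent_unique_iff (v := fun _ : Fin 1 => ω)).mpr hω
  · rw [superenergy_one he hN']
    congr 1
    ext v
    rw [toDual_apply, wedge_apply]
    simp

theorem smul_metric_mem_SS {e : Module.Basis (Fin N) ℝ V} (hN : 2 ≤ N) {μ : ℝ} (hμ : 0 < μ) :
    μ • g ∈ SS g e := by
  obtain ⟨n, rfl⟩ : ∃ n, N = n + 1 := ⟨N - 1, by omega⟩
  -- The first covector carries the whole factor `f = √(2μ)`, for which `½ f² = μ`.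
  set s : Fin (n + 1) → ℝ := fun i => if i = 0 then √(2 * μ) else 1 with hs
  have hs0 : ∀ i, s i ≠ 0 := fun i => by
    have : 0 < √(2 * μ) := by positivity
    simp only [hs]
    split_ifs
    exacts [this.ne', one_ne_zero]
  refine ⟨n, 0, rfl, wedge fun i => s i • e.coord i, ⟨_, ?_, rfl⟩, ?_⟩
  · refine Fintype.linearIndependent_iff.mpr fun c hc j => ?_
    have := LinearMap.congr_fun hc (e j)
    simpa [Finsupp.single_apply, hs0 j] using this
  · have hd : wedge (fun i => s i • e.coord i) e = √(2 * μ) := by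
      have : (Matrix.of fun i j => (s j • e.coord j) (e i)) = Matrix.diagonal s := by
        ext i j
        by_cases hij : i = j
        · subst hij; simp
        · simp [hij, Finsupp.single_apply]
      rw [wedge_apply, this, Matrix.det_diagonal, Fin.prod_univ_succ]
      simp [hs]
    change _ = ((1 / 2 : ℝ) * wedge (fun i => s i • e.coord i) e ^ 2) • g
    rw [hd, Real.sq_sqrt (by positivity)]
    congr 1; ring

/-- The map of `T` is `μ` on the plane of `u` and `w` and `-μ` on its orthogonal complement. The
form is `F = √(2μ) u ∧ w`, with `F ⊙ F = 2μ (u ⊗ u - w ⊗ w)` and `F_{ab} F^{ab} = -4μ`. -/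
theorem simple_two_mem_SS {e : Module.Basis (Fin 4) ℝ V} (he : IsLorentzFrame g e) {u w : V}
    (huu : g u u = 1) (hww : g w w = -1) (huw : g u w = 0) {μ : ℝ} (hμ : 0 < μ) {T : BilinForm ℝ V}
    (hT : ∀ x y, T x y = μ * (2 * (g u x * g u y) - 2 * (g w x * g w y) - g x y)) :
    T ∈ SS g e := by
  set s := √(2 * μ) with hs
  have hs2 : s ^ 2 = 2 * μ := Real.sq_sqrt (by positivity)
  have hs0 : s ≠ 0 := (Real.sqrt_pos.mpr (by positivity)).ne'
  have hwu : g w u = 0 := by rw [he.comm, huw]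
  set F : V [⋀^Fin 2]→ₗ[ℝ] ℝ := wedge ![s • g u, g w] with hF
  have hFv : ∀ x y, F ![x, y] = s * (g u x * g w y - g w x * g u y) := fun x y => by
    rw [hF, wedge_apply, Matrix.det_fin_two]
    simp
    ring
  have hsq : ∀ x y, semiSquare e F x y = 2 * μ * (g u x * g u y - g w x * g w y) := fun x y => by
    have : ∑ c, sgn c * (F ![x, e c] * F ![y, e c]) = s ^ 2 * (g u x * g u y * g w w -
        g u x * g w y * g w u - g w x * g u y * g u w + g w x * g w y * g u u) := by
      simp only [← he.sum_mul w w, ← he.sum_mul w u, ← he.sum_mul u w, ← he.sum_mul u u, hFv,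
        Finset.mul_sum, ← Finset.sum_add_distrib, ← Finset.sum_sub_distrib]
      exact Finset.sum_congr rfl fun c _ => by ring
    rw [semiSquare_two, this, huu, hww, huw, hwu, hs2]
    ring
  have htr : ∑ a, ∑ b, sgn a * sgn b * F ![e a, e b] ^ 2 = -4 * μ := by
    have : ∀ a, ∑ b, sgn a * sgn b * F ![e a, e b] ^ 2 = -(sgn a * semiSquare e F (e a) (e a)) :=
      fun a => by
        rw [semiSquare_two, mul_neg, neg_neg, Finset.mul_sum]
        exact Finset.sum_congr rfl fun c _ => by ring
    simp only [this, hsq]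
    have h2 : ∑ a, -(sgn a * (2 * μ * (g u (e a) * g u (e a) - g w (e a) * g w (e a)))) =
        -(2 * μ) * (g u u - g w w) := by
      simp only [← he.sum_mul w w, ← he.sum_mul u u, Finset.mul_sum, ← Finset.sum_sub_distrib]
      exact Finset.sum_congr rfl fun c _ => by ring
    rw [h2, huu, hww]; ring
  refine ⟨1, 2, rfl, F, ⟨_, ?_, rfl⟩, ?_⟩
  · refine LinearIndependent.pair_iff.mpr fun a b hab => ?_
    have h1 := LinearMap.congr_fun hab u
    have h2 := LinearMap.congr_fun hab w
    simp [huu, hwu, huw, hww, hs0] at h1 h2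
    exact ⟨h1, h2⟩
  · refine ext_frame e fun i j => ?_
    rw [superenergy_two_four he rfl, htr, hT, LinearMap.add_apply, LinearMap.add_apply, hsq,
      LinearMap.smul_apply, LinearMap.smul_apply, smul_eq_mul]
    ring

theorem dual_mem_SS {e : Module.Basis (Fin N) ℝ V} (he : IsLorentzFrame g e) (hN : 2 ≤ N)
    (hN' : N ≤ 4) {w : V} (hw : w ≠ 0) {c : ℝ} (hc : 0 < c) {T : BilinForm ℝ V}
    (hT : ∀ x y, T x y = c * (g w x * g w y - 1 / 2 * g w w * g x y)) : T ∈ SS g e := by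
  have hs2 : √c ^ 2 = c := Real.sq_sqrt hc.le
  have h0 : g (√c • w) ≠ 0 := fun h0 => by
    have : √c • w = 0 := he.eq_of_forall fun x => by rw [h0]; simp
    rcases smul_eq_zero.mp this with h | h
    · exact (Real.sqrt_pos.mpr hc).ne' h
    · exact hw h
  convert dualSuperenergy_mem_SS he hN hN' h0
  refine ext_frame e fun i j => ?_
  rw [dualSuperenergy_dual he (w := √c • w) fun _ => rfl, hT]
  simp only [map_smul, LinearMap.smul_apply, smul_eq_mul]
  linear_combination (-(g w (e i) * g w (e j)) + 1 / 2 * g w w * g (e i) (e j)) * hs2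

end Simple

/-! ### Classification of symmetric orthochronous tensors -/

section Classification

variable {V : Type*} [AddCommGroup V] [Module ℝ V] {N : ℕ} {g : BilinForm ℝ V}
  {e : Module.Basis (Fin N) ℝ V}

/-- The weak energy condition for the timelike frame vector. -/
theorem IsOrthochronous.frame_nonneg [NeZero N] (he : IsLorentzFrame g e) (hN : 2 ≤ N)
    {T : BilinForm ℝ V} (h : IsOrthochronous g (e 0) (raise e T)) : 0 ≤ T (e 0) (e 0) := by
  have s0 : sgn (0 : Fin N) = 1 := by simp [sgn]
  have s1 : sgn (⟨1, hN⟩ : Fin N) = -1 := by simp [sgn]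
  have hne : (⟨1, hN⟩ : Fin N) ≠ 0 := fun h => by simpa using congrArg Fin.val h
  have ht : 0 < g (e 0) (e 0) := by simp [he _ _, s0]
  have p : IsFutureNull g (e 0) (e 0 + e ⟨1, hN⟩) := by
    constructor <;> simp [he _ _, s0, s1, hne, hne.symm]
  have m : IsFutureNull g (e 0) (e 0 - e ⟨1, hN⟩) := by
    constructor <;> simp [he _ _, s0, s1, hne, hne.symm]
  have key : ∀ k l, IsFutureNull g (e 0) k → IsFutureNull g (e 0) l → 0 ≤ T k l :=
    fun k l hk hl => by
      rw [← metric_raise he]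
      rcases h.2 k hk with h0 | h0
      · simp [h0]
      · exact he.future_mul_nonneg ht h0 hl
  -- The four values add up to `4 * T (e 0) (e 0)`.
  have h1 := key _ _ p p
  have h2 := key _ _ p m
  have h3 := key _ _ m p
  have h4 := key _ _ m m
  simp only [map_add, map_sub, LinearMap.add_apply, LinearMap.sub_apply] at h1 h2 h3 h4
  linarith

theorem IsLorentzFrame.exists_unit (he : IsLorentzFrame g e) {τ x : V} (hτ : 0 < g τ τ)
    (hx : g τ x = 0) (hx0 : x ≠ 0) : ∃ c : ℝ, c ≠ 0 ∧ g (c • x) (c • x) = -1 := by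
  obtain ⟨h1, h2⟩ := he.orthogonal_timelike hτ hx
  have h3 : 0 < -g x x := neg_pos.mpr (lt_of_le_of_ne h1 fun h => hx0 (h2 h))
  have h4 : 0 < √(-g x x) := Real.sqrt_pos.mpr h3
  refine ⟨(√(-g x x))⁻¹, inv_ne_zero h4.ne', ?_⟩
  have h5 := Real.mul_self_sqrt h3.le
  simp only [map_smul, LinearMap.smul_apply, smul_eq_mul]
  field_simp
  linarith

/-- The image is totally null, hence a line, and symmetry makes `T = γ x ⊗ x`. Since `x` is null,
the metric term of the one-form tensor drops out. -/
theorem mem_SS_of_nilpotent [NeZero N] (he : IsLorentzFrame g e) (hN : 2 ≤ N) (hN' : N ≤ 4)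
    {T : BilinForm ℝ V} (hT : T.IsSymm) (hT0 : T ≠ 0) (h00 : 0 ≤ T (e 0) (e 0))
    (hf : ∀ u v, g (raise e T u) (raise e T v) = 0) : T ∈ SS g e := by
  have ht : 0 < g (e 0) (e 0) := by simp [he _ _, sgn]
  obtain ⟨v, hv⟩ : ∃ v, raise e T v ≠ 0 := by
    by_contra! hc
    refine hT0 (ext_frame e fun i j => ?_)
    rw [← metric_raise he, hc]; simp
  set x := raise e T v with hx
  have hx0 : g (e 0) x ≠ 0 := fun h => hv ((he.orthogonal_timelike ht h).2 (hf v v))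
  have hpar : ∀ u y, T u y = g (e 0) (raise e T u) / g (e 0) x * g x y := fun u y => by
    have := he.null_parallel ht (hf v v) hx0 (hf u u) (hf v u)
    rw [← metric_raise he]
    conv_lhs => rw [this]
    rw [map_smul, LinearMap.smul_apply, smul_eq_mul]
  set γ := g (e 0) (raise e T (e 0)) / g (e 0) x / g (e 0) x with hγ
  have hγT : ∀ u y, T u y = γ * (g x u * g x y) := fun u y => by
    have h1 := hT.eq u (e 0)
    rw [hpar u, hpar (e 0), he.comm x (e 0)] at h1
    have h2 : g (e 0) (raise e T u) / g (e 0) x = γ * g x u := by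
      rw [hγ, div_mul_eq_mul_div, eq_div_iff hx0]
      linarith
    rw [hpar, h2]; ring
  have hγ0 : 0 < γ := by
    refine lt_of_le_of_ne ?_ fun h => hT0 (ext_frame e fun i j => by rw [hγT, ← h]; simp)
    rw [hγT, he.comm x] at h00
    exact nonneg_of_mul_nonneg_left h00 (mul_self_pos.mpr hx0)
  refine dual_mem_SS he hN hN' hv hγ0 fun u y => ?_
  rw [hγT, hf]; ring

/-- The proof splits by the dimensions of the eigenspaces `E₊`, `E₋` of `μ`, `-μ`. A vector where
the formula for one case fails yields a new eigenvector orthogonal to those already found. -/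
theorem mem_SS_of_conformal [NeZero N] (he : IsLorentzFrame g e) (hN : 2 ≤ N) (hN' : N ≤ 4)
    {T : BilinForm ℝ V} (hT : T.IsSymm) (h00 : 0 ≤ T (e 0) (e 0)) {μ : ℝ} (hμ : 0 < μ)
    (hf : ∀ u v, g (raise e T u) (raise e T v) = μ ^ 2 * g u v)
    (hff : ∀ u, raise e T (raise e T u) = μ ^ 2 • u) : T ∈ SS g e := by
  have hTf := fun u v => (metric_raise he T u v).symm
  have hsa := raise_self_adjoint he hT
  set f := raise e T
  have hg0 : g (e 0) (e 0) = 1 := by simp [he _ _, sgn]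
  have orth : ∀ a b, f a = μ • a → f b = -μ • b → g a b = 0 := fun a b ha hb => by
    have := hsa a b
    rw [ha, hb] at this
    simp only [map_smul, LinearMap.smul_apply, smul_eq_mul] at this
    nlinarith
  obtain ⟨u, huu, hfu⟩ : ∃ u, g u u = 1 ∧ f u = μ • u := by
    -- Up to a factor `2μ`, the projection of `e 0` to `E₊`; it is timelike because `T (e 0) (e 0) ≥
    -- 0`.
    set p := f (e 0) + μ • e 0 with hp
    have hpp : 0 < g p p := by
      have h1 : g p p = μ ^ 2 + 2 * μ * T (e 0) (e 0) + μ ^ 2 := by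
        simp only [hp, map_add, map_smul, LinearMap.add_apply, LinearMap.smul_apply, hf, hg0,
          smul_eq_mul, he.comm (e 0) (f (e 0)), ← hTf]
        ring
      rw [h1]; positivity
    have h4 : 0 < √(g p p) := Real.sqrt_pos.mpr hpp
    refine ⟨(√(g p p))⁻¹ • p, ?_, ?_⟩
    · have h5 := Real.mul_self_sqrt hpp.le
      simp only [map_smul, LinearMap.smul_apply, smul_eq_mul]
      field_simp
      linarith
    · have h6 : f p = μ • p := by rw [hp, map_add, map_smul, hff]; module
      rw [map_smul, h6, smul_comm]
  have hu0 : u ≠ 0 := fun h => by simp [h] at huu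
  have hut : 0 < g u u := by rw [huu]; exact one_pos
  by_cases ha : ∀ v, f v = μ • v
  · have : T = μ • g := ext_frame e fun i j => by rw [hTf, ha]; simp
    rw [this]
    exact smul_metric_mem_SS hN hμ
  obtain ⟨v, hv⟩ := not_forall.mp ha
  obtain ⟨z, hzz, hfz⟩ : ∃ z, g z z = -1 ∧ f z = -μ • z := by
    have h1 : f (f v - μ • v) = -μ • (f v - μ • v) := by
      rw [map_sub, map_smul, hff]; module
    obtain ⟨c, -, hc⟩ := he.exists_unit hut (orth _ _ hfu h1) (sub_ne_zero.mpr hv)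
    exact ⟨_, hc, by rw [map_smul, h1, smul_comm]⟩
  have huz := orth _ _ hfu hfz
  have hz0 : z ≠ 0 := fun h => by simp [h] at hzz
  -- The case that `E₋` is the line of `z`.
  by_cases hb : ∀ v, f v = μ • v + (2 * μ * g z v) • z
  · refine dual_mem_SS he hN hN' hz0 (c := 2 * μ) (by positivity) fun x y => ?_
    rw [hTf, hb, hzz]
    simp; ring
  obtain ⟨v', hv'⟩ := not_forall.mp hb
  obtain ⟨y, hzy, hfy, hyy⟩ : ∃ y, g z y = 0 ∧ f y = -μ • y ∧ g y y ≠ 0 := by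
    set y := f v' - (μ • v' + (2 * μ * g z v') • z) with hy
    have h1 : f y = -μ • y := by
      rw [hy, map_sub, map_add, map_smul, map_smul, hff, hfz]; module
    refine ⟨y, ?_, h1, fun h => ?_⟩
    · have : g z (f v') = -μ * g z v' := by rw [← hsa, hfz]; simp
      simp [hy, this, hzz]; ring
    · exact sub_ne_zero.mpr hv' ((he.orthogonal_timelike hut (orth _ _ hfu h1)).2 h)
  have huy := orth _ _ hfu hfy
  -- The case that `E₊` is the line of `u`.
  by_cases hd : ∀ v, f v = (2 * μ * g u v) • u - μ • v
  · refine dual_mem_SS he hN hN' hu0 (c := 2 * μ) (by positivity) fun x y => ?_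
    rw [hTf, hd, huu]
    simp; ring
  obtain ⟨v'', hv''⟩ := not_forall.mp hd
  obtain ⟨w, huw, hww, hfw⟩ : ∃ w, g u w = 0 ∧ g w w = -1 ∧ f w = μ • w := by
    set w := f v'' - ((2 * μ * g u v'') • u - μ • v'') with hw
    have h1 : f w = μ • w := by
      rw [hw, map_sub, map_sub, map_smul, map_smul, hff, hfu]; module
    have h2 : g u w = 0 := by
      have : g u (f v'') = μ * g u v'' := by rw [← hsa, hfu]; simp
      simp [hw, this, huu]; ring
    obtain ⟨c, -, hc⟩ := he.exists_unit hut h2 (sub_ne_zero.mpr hv'')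
    exact ⟨_, by simp [h2], hc, by rw [map_smul, h1, smul_comm]⟩
  have hwz := orth _ _ hfw hfz
  have hwy := orth _ _ hfw hfy
  -- Four orthogonal non-null vectors, two in each eigenspace, force `N = 4` and form a basis that
  -- determines `T`.
  have hli : LinearIndependent ℝ ![u, w, z, y] := by
    refine BilinForm.linearIndependent_of_iIsOrtho (B := g) ?_ fun i => ?_
    · rw [BilinForm.iIsOrtho_def]
      intro i j hij
      fin_cases i <;> fin_cases j <;>
        simp [huw, huz, huy, hwz, hwy, hzy, he.comm w u, he.comm z u, he.comm y u, he.comm z w,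
          he.comm y w, he.comm y z] at hij ⊢
    · fin_cases i <;> simp [huu, hww, hzz, hyy]
  have hfin : Module.finrank ℝ V = N := by simp [Module.finrank_eq_card_basis e]
  have : FiniteDimensional ℝ V := Module.Basis.finiteDimensional_of_finite e
  have hN4 : 4 ≤ N := by
    have := hli.fintype_card_le_finrank
    simpa [hfin] using this
  obtain rfl : N = 4 := le_antisymm hN' hN4
  refine simple_two_mem_SS he huu hww huw hμ fun x t => ?_
  have hS : T = μ • ((2 : ℝ) • (g u).smulRight (g u) - (2 : ℝ) • (g w).smulRight (g w) - g) := by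
    refine (basisOfLinearIndependentOfCardEqFinrank hli (by simp [hfin])).ext fun i =>
      LinearMap.ext fun t => ?_
    rw [coe_basisOfLinearIndependentOfCardEqFinrank, hTf]
    fin_cases i <;>
      simp [hfu, hfw, hfz, hfy, huu, hww, huw, huz, huy, hwz, hwy, he.comm w u, hμ.ne'] <;> ring
  rw [hS]
  simp

theorem mem_SS_of_isOrthochronous (he : IsLorentzFrame g e) (hN : 2 ≤ N) (hN' : N ≤ 4) {τ : V}
    (hτ : 0 < g τ τ) {T : BilinForm ℝ V} (hT : T.IsSymm) (h : IsOrthochronous g τ (raise e T))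
    (hT0 : T ≠ 0) : T ∈ SS g e := by
  have : NeZero N := ⟨by omega⟩
  have h00 := IsOrthochronous.frame_nonneg he hN
    (he.isOrthochronous_congr hτ (by simp [he _ _, sgn]) h)
  obtain ⟨l, hl, h1, h2⟩ := exists_raise_sq hN he hτ hT h
  rcases hl.eq_or_lt with rfl | hl
  · exact mem_SS_of_nilpotent he hN hN' hT hT0 h00 fun u v => by rw [h1, zero_mul]
  · rw [← Real.sq_sqrt hl.le] at h1 h2
    exact mem_SS_of_conformal he hN hN' hT h00 (Real.sqrt_pos.mpr hl) h1 h2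

theorem SE₂_eq (he : IsLorentzFrame g e) (hN : 2 ≤ N) (hN' : N ≤ 4) {τ : V} (hτ : 0 < g τ τ) :
    SE₂ g e = {T | T.IsSymm ∧ IsOrthochronous g τ (raise e T)} := by
  ext T
  constructor
  · rintro ⟨k, q, h, Ω, rfl⟩
    exact superenergy_isSymm_isOrthochronous he hN' hτ h Ω
  · rintro ⟨hT, h⟩
    by_cases hT0 : T = 0
    · exact ⟨0, N - 1, by omega, 0, by rw [hT0, superenergy_zero]⟩
    · obtain ⟨k, q, hp, Ω, -, rfl⟩ := mem_SS_of_isOrthochronous he hN hN' hτ hT h hT0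
      exact ⟨k, q, hp, Ω, rfl⟩

theorem SE₂_diff_zero (he : IsLorentzFrame g e) (hN : 2 ≤ N) (hN' : N ≤ 4) {τ : V}
    (hτ : 0 < g τ τ) : SE₂ g e \ {0} = SS g e := by
  ext T
  constructor
  · rintro ⟨hT, hT0⟩
    rw [SE₂_eq he hN hN' hτ] at hT
    exact mem_SS_of_isOrthochronous he hN hN' hτ hT.1 hT.2 hT0
  · rintro ⟨k, q, h, Ω, hΩ, rfl⟩
    exact ⟨⟨k, q, h, Ω, rfl⟩, fun h0 => hΩ.ne_zero (superenergy_eq_zero he hN hN' h h0)⟩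

theorem IsOrthochronous.smul {τ : V} {f : V →ₗ[ℝ] V} (h : IsOrthochronous g τ f) {c : ℝ}
    (hc : 0 < c) : IsOrthochronous g τ (c • f) := by
  refine ⟨fun k hk => by simp [h.1 k hk], fun k hk => ?_⟩
  refine (h.2 k hk).imp (fun h0 => by simp [h0]) fun ⟨h1, h2⟩ => ⟨by simp [h1], ?_⟩
  simp only [LinearMap.smul_apply, map_smul, smul_eq_mul]
  positivity

/-- Symmetric orthochronous tensors are positive multiples of involutory Lorentz transformations,
or singular. -/
theorem orthochronous_eq_union (he : IsLorentzFrame g e) (hN : 2 ≤ N) {τ : V} (hτ : 0 < g τ τ) :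
    {T : BilinForm ℝ V | T.IsSymm ∧ IsOrthochronous g τ (raise e T)} =
      {T | ∃ c : ℝ, 0 < c ∧ ∃ L : V →ₗ[ℝ] V, IsLorentzTransformation g L ∧
          IsInvolutory L ∧ IsOrthochronous g τ L ∧ raise e T = c • L} ∪
      {T | T.IsSymm ∧ IsSingular (raise e T) ∧ IsOrthochronous g τ (raise e T) ∧
          IsNullConeBiPreserving g e T} := by
  ext T
  constructor
  · rintro ⟨hT, h⟩
    obtain ⟨l, hl, h1, h2⟩ := exists_raise_sq hN he hτ hT h
    rcases hl.eq_or_lt with rfl | hl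
    · refine Or.inr ⟨hT, ?_, h, h.1, ?_⟩
      · have h0 : raise e T ∘ₗ raise e T = 0 := LinearMap.ext fun u => by simp [h2]
        have hfin : Module.finrank ℝ V = N := by simp [Module.finrank_eq_card_basis e]
        have hd := LinearMap.det_comp (raise e T) (raise e T)
        rw [h0, LinearMap.det_zero, hfin, zero_pow (by omega)] at hd
        exact mul_self_eq_zero.mp hd.symm
      · have : T.flip = T := LinearMap.ext fun u => LinearMap.ext fun v => hT.eq v u
        rw [this]; exact h.1
    · have hs : 0 < √l := Real.sqrt_pos.mpr hl
      have hs2 := Real.mul_self_sqrt hl.le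
      refine Or.inl ⟨√l, hs, (√l)⁻¹ • raise e T, fun u v => ?_, ?_, h.smul (inv_pos.mpr hs), ?_⟩
      · simp only [LinearMap.smul_apply, map_smul, smul_eq_mul, h1]
        field_simp
        rw [pow_two, hs2]
      · refine LinearMap.ext fun u => ?_
        simp only [LinearMap.comp_apply, LinearMap.smul_apply, map_smul, h2, smul_smul,
          LinearMap.id_apply]
        have h4 : (√l)⁻¹ * ((√l)⁻¹ * l) = 1 := by
          field_simp
          rw [pow_two, hs2]
        rw [h4, one_smul]
      · rw [smul_inv_smul₀ hs.ne']
  · rintro (⟨c, hc, L, hL, hi, ho, hr⟩ | ⟨hT, -, h, -⟩)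
    · refine ⟨⟨fun u v => ?_⟩, hr ▸ ho.smul hc⟩
      -- An isometry that is its own inverse is self-adjoint, so `T` is symmetric.
      have hLL : ∀ v, L (L v) = v := fun v => LinearMap.congr_fun hi v
      rw [← metric_raise he, ← metric_raise he T v, hr]
      simp only [LinearMap.smul_apply, map_smul, smul_eq_mul]
      rw [← hL (L v), hLL, he.comm]
    · exact ⟨hT, h⟩

/-! ### Negation and time reversal -/

theorem raise_neg (e : Module.Basis (Fin N) ℝ V) (T : BilinForm ℝ V) :
    raise e (-T) = -raise e T := by
  ext u
  simp [raise]

theorem isNullConePreserving_neg {f : V →ₗ[ℝ] V} :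
    IsNullConePreserving g (-f) ↔ IsNullConePreserving g f := by
  simp [IsNullConePreserving]

theorem isOrthochronous_neg {τ : V} {f : V →ₗ[ℝ] V} :
    IsOrthochronous g τ (-f) ↔ IsTimeReversal g τ f := by
  simp [IsOrthochronous, IsTimeReversal, isNullConePreserving_neg]

theorem isNullConeBiPreserving_neg {T : BilinForm ℝ V} :
    IsNullConeBiPreserving g e (-T) ↔ IsNullConeBiPreserving g e T := by
  have : (-T).flip = -T.flip := rfl
  rw [IsNullConeBiPreserving, IsNullConeBiPreserving, this, raise_neg, raise_neg,
    isNullConePreserving_neg, isNullConePreserving_neg]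

theorem isSingular_neg {f : V →ₗ[ℝ] V} : IsSingular (-f) ↔ IsSingular f := by
  rw [IsSingular, IsSingular, ← neg_one_smul ℝ f, LinearMap.det_smul]
  simp

theorem isSymm_neg {T : BilinForm ℝ V} : (-T).IsSymm ↔ T.IsSymm :=
  ⟨fun h => ⟨fun u v => by simpa using h.eq u v⟩, fun h => ⟨fun u v => by simpa using h.eq u v⟩⟩

/-- The sign passes from `T` to `L`, leaving `c` positive; `-L` is still an involutory isometry. -/
theorem exists_involution_neg {τ : V} {T : BilinForm ℝ V} :
    (∃ c : ℝ, 0 < c ∧ ∃ L : V →ₗ[ℝ] V, IsLorentzTransformation g L ∧ IsInvolutory L ∧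
      IsOrthochronous g τ L ∧ raise e (-T) = c • L) ↔
    ∃ c : ℝ, 0 < c ∧ ∃ L : V →ₗ[ℝ] V, IsLorentzTransformation g L ∧ IsInvolutory L ∧
      IsTimeReversal g τ L ∧ raise e T = c • L := by
  have hl : ∀ L : V →ₗ[ℝ] V, IsLorentzTransformation g (-L) ↔ IsLorentzTransformation g L :=
    fun L => by simp [IsLorentzTransformation]
  have hi : ∀ L : V →ₗ[ℝ] V, IsInvolutory (-L) ↔ IsInvolutory L := fun L => by
    simp [IsInvolutory, LinearMap.neg_comp, LinearMap.comp_neg]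
  refine exists_congr fun c => and_congr_right fun _ => ?_
  constructor
  · rintro ⟨L, h1, h2, h3, h4⟩
    refine ⟨-L, (hl L).mpr h1, (hi L).mpr h2, isOrthochronous_neg.mp (by rwa [neg_neg]), ?_⟩
    rw [smul_neg, ← h4, raise_neg, neg_neg]
  · rintro ⟨L, h1, h2, h3, h4⟩
    refine ⟨-L, (hl L).mpr h1, (hi L).mpr h2, isOrthochronous_neg.mpr h3, ?_⟩
    rw [smul_neg, ← h4, raise_neg]

end Classification

end Superenergy

theorem mainTheorem11 {V : Type*} [AddCommGroup V] [Module ℝ V] {N : ℕ} (hN : 2 ≤ N) (hN' : N ≤ 4)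
    (g : LinearMap.BilinForm ℝ V) (e : Module.Basis (Fin N) ℝ V)
    (he : Superenergy.IsLorentzFrame g e) (τ : V) (hτ : 0 < g τ τ) :
    Superenergy.SE₂ g e \ {0} = Superenergy.SS g e ∧
    Superenergy.SE₂ g e =
      {T | T.IsSymm ∧ Superenergy.IsOrthochronous g τ (Superenergy.raise e T)} ∧
    Superenergy.SE₂ g e =
      {T | ∃ c : ℝ, 0 < c ∧ ∃ L : V →ₗ[ℝ] V, Superenergy.IsLorentzTransformation g L ∧
          Superenergy.IsInvolutory L ∧ Superenergy.IsOrthochronous g τ L ∧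
          Superenergy.raise e T = c • L} ∪
      {T | T.IsSymm ∧ Superenergy.IsSingular (Superenergy.raise e T) ∧
          Superenergy.IsOrthochronous g τ (Superenergy.raise e T) ∧
          Superenergy.IsNullConeBiPreserving g e T} ∧
    {T | -T ∈ Superenergy.SE₂ g e} =
      {T | T.IsSymm ∧ Superenergy.IsTimeReversal g τ (Superenergy.raise e T)} ∧
    {T | -T ∈ Superenergy.SE₂ g e} =
      {T | ∃ c : ℝ, 0 < c ∧ ∃ L : V →ₗ[ℝ] V, Superenergy.IsLorentzTransformation g L ∧
          Superenergy.IsInvolutory L ∧ Superenergy.IsTimeReversal g τ L ∧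
          Superenergy.raise e T = c • L} ∪
      {T | T.IsSymm ∧ Superenergy.IsSingular (Superenergy.raise e T) ∧
          Superenergy.IsTimeReversal g τ (Superenergy.raise e T) ∧
          Superenergy.IsNullConeBiPreserving g e T} := by
  have h2 := Superenergy.SE₂_eq he hN hN' hτ
  have h3 := h2.trans (Superenergy.orthochronous_eq_union he hN hτ)
  refine ⟨Superenergy.SE₂_diff_zero he hN hN' hτ, h2, h3, ?_, ?_⟩
  · ext T
    rw [Set.mem_ofPred_eq, h2, Set.mem_ofPred_eq, Set.mem_ofPred_eq, Superenergy.isSymm_neg,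
      Superenergy.raise_neg, Superenergy.isOrthochronous_neg]
  · ext T
    rw [Set.mem_ofPred_eq, h3]
    refine or_congr Superenergy.exists_involution_neg ?_
    rw [Set.mem_ofPred_eq, Set.mem_ofPred_eq, Superenergy.isSymm_neg,
      Superenergy.isNullConeBiPreserving_neg, Superenergy.raise_neg, Superenergy.isSingular_neg,
      Superenergy.isOrthochronous_neg]
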